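/- Notation. For an integer $K\ge 0$ put $\Lambda_K=\{(m,n)\in\mathbb N_0^2: m+n\le K\}$ and $\Lambda_K^{V,1}=\{(m,n)\in\Lambda_K: m\in\{0,1\}\}$. Fix an integer $M\ge 1$. Setting. Let $\Omega=(l_1,l_2)\times(l_3,l_4)$, let $\psi$ be continuous on $\Omega$, and put $\Omega^{\pm}=\{p\in\Omega:\pm\psi(p)>0\}$, $\Gamma_I=\{p\in\Omega:\psi(p)=0\}$. Assume that near each of its points $\Gamma_I$ is an embedded $C^1$ curve with $\Omega^+$ on one side and $\Omega^-$ on the other (for example, $\psi$ is smooth with $\nabla\psi\ne0$ on $\Gamma_I$), and let $\vec n$ be its unit normal pointing towards $\Omega^+$. Let $a$, $u$ and $f$ have uniformly continuous partial derivatives of total orders up to $M$, $M+1$ and $M-1$, respectively, in each of $\Omega^+$ and $\Omega^-$, let $a>0$ in $\Omega\setminus\Gamma_I$, and let both one-sided limits of $a$ be positive at every point of $\Gamma_I$. Assume that $$-\nabla\cdot(a\nabla u)=f\ \text{ in }\Omega\setminus\Gamma_I,\qquad [u]=g_D,\quad [a\nabla u\cdot\vec n]=g_N\ \text{ on }\Gamma_I,$$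 where $[\,\cdot\,]$ is the limit from $\Omega^+$ minus the limit from $\Omega^-$ (no condition on $\partial\Omega$ is needed). Let $(x^*,y^*)\in\Gamma_I$, and let $g_D$ and $g_N$ be functions on the plane that are $C^{M+1}$ and $C^M$, respectively, near $(x^*,y^*)$. Let $t\mapsto(x^*+r(t),y^*+s(t))\in\Gamma_I$, $t\in(-\epsilon,\epsilon)$, $\epsilon>0$, be a $C^{M+1}$ parametrization with $r(0)=s(0)=0$ and $(r')^2+(s')^2>0$, and let $\sigma\in\{1,-1\}$ be the sign for which $\vec n(x^*,y^*)=\sigma\,(s'(0),-r'(0))/\sqrt{r'(0)^2+s'(0)^2}$. Write $g_D^{(m,n)}$ and $g_N^{(m,n)}$ for the values at $(x^*,y^*)$ of the derivatives $\partial^{m+n}/\partial x^m\partial y^n$ of $g_D$ and $g_N$, and $a_\pm^{(m,n)},u_\pm^{(m,n)},f_\pm^{(m,n)}$ for the limits at $(x^*,y^*)$, from within $\Omega^\pm$, of the corresponding derivatives of $a,u,f$. Theorem. There are real coefficients $T^{u_+}_{m',n',m,n}$, $T^{+}_{m',n',m,n}$, $T^{-}_{m',n',m,n}$, $T^{g_D}_{m',n',m,n}$,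 $T^{g_N}_{m',n',m,n}$ that are functions only of the numbers $r^{(k)}(0),s^{(k)}(0)$ $(k=0,\dots,M+1)$ and $a_\pm^{(m,n)}$ $((m,n)\in\Lambda_M)$, the same functions for all problems, base points and parametrizations as above, such that for all $(m',n')\in\Lambda_{M+1}^{V,1}$ $$\begin{aligned}u_-^{(m',n')}={}&\sum_{\substack{(m,n)\in\Lambda_{M+1}^{V,1}\\ m+n\le m'+n'}}T^{u_+}_{m',n',m,n}\,u_+^{(m,n)}+\sum_{(m,n)\in\Lambda_{M-1}}\bigl(T^+_{m',n',m,n}\,f_+^{(m,n)}+T^-_{m',n',m,n}\,f_-^{(m,n)}\bigr)\\&+\sum_{(m,n)\in\Lambda_{M+1}}T^{g_D}_{m',n',m,n}\,g_D^{(m,n)}+\sigma\sum_{(m,n)\in\Lambda_M}T^{g_N}_{m',n',m,n}\,g_N^{(m,n)}.\end{aligned}$$ Moreover, for $(m,n),(m',n')\in\Lambda_{M+1}^{V,1}$ with $m+n=m'+n'$, the coefficient $T^{u_+}_{m',n',m,n}$ depends only on $r^{(k)}(0),s^{(k)}(0)$ $(k=0,\dots,M+1)$ and on $a_+^{(0,0)},a_-^{(0,0)}$.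 In particular, $T^{u_+}_{0,0,0,0}=1$, and $T^{u_+}_{m',n',0,0}=0$ for all $(m',n')\in\Lambda_{M+1}^{V,1}$ with $(m',n')\ne(0,0)$. -/

import Mathlib

open Filter Topology

noncomputable section

namespace EllipticInterface

/-! ### Index sets -/

/-- `Λ_K`: all pairs `(m, n)` of nonnegative integers with `m + n ≤ K`. -/
def Lam (K : ℕ) : Finset (ℕ × ℕ) :=
  (Finset.range (K + 1)).biUnion fun k => Finset.HasAntidiagonal.antidiagonal k

theorem mem_Lam {K : ℕ} {q : ℕ × ℕ} : q ∈ Lam K ↔ q.1 + q.2 ≤ K := by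
  simp [Lam]

/-- `Λ_K^{V,1}`: the pairs `(0, n)` with `n ≤ K` and the pairs `(1, n)` with `1 + n ≤ K`. -/
def LamV1 (K : ℕ) : Finset (ℕ × ℕ) := (Lam K).filter fun q => q.1 ≤ 1

theorem mem_LamV1 {K : ℕ} {q : ℕ × ℕ} : q ∈ LamV1 K ↔ q.1 + q.2 ≤ K ∧ q.1 ≤ 1 := by
  simp [LamV1, mem_Lam]

/-! ### Partial derivatives -/

/-- The partial derivative `∂F/∂x`. -/
def partialX (F : ℝ × ℝ → ℝ) : ℝ × ℝ → ℝ := fun p => deriv (fun x => F (x, p.2)) p.1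

/-- The partial derivative `∂F/∂y`. -/
def partialY (F : ℝ × ℝ → ℝ) : ℝ × ℝ → ℝ := fun p => deriv (fun y => F (p.1, y)) p.2

/-- The partial derivative `∂^{m+n} F / ∂x^m ∂y^n`, where `q = (m, n)`. -/
def pderiv (q : ℕ × ℕ) (F : ℝ × ℝ → ℝ) : ℝ × ℝ → ℝ := partialX^[q.1] (partialY^[q.2] F)

/-- `F` has uniformly continuous partial derivatives of total orders up to `k` in the open
set `S`. -/
def UniformlySmoothOn (k : ℕ) (F : ℝ × ℝ → ℝ) (S : Set (ℝ × ℝ)) : Prop :=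
  ContDiffOn ℝ k F S ∧ ∀ q ∈ Lam k, UniformContinuousOn (pderiv q F) S

/-- The limit of `F` at `p` from within `S`. -/
def limFrom (S : Set (ℝ × ℝ)) (F : ℝ × ℝ → ℝ) (p : ℝ × ℝ) : ℝ := limUnder (𝓝[S] p) F

/-! ### The interface problem -/

/-- `n` is the unit normal at `p` of the zero set of `ψ`, pointing towards `{ψ > 0}`. Near `p`,
the sets `{ψ > 0}` and `{ψ < 0}` are the two sides of an embedded `C¹` curve through `p`: they are
the sets `{φ > 0}` and `{φ < 0}` for a `C¹` function `φ` with nonvanishing gradient, which is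
normalized here to `∇φ(p) = n`. If `∇ψ(p) ≠ 0`, then `φ` can be a multiple of `ψ`. -/
def IsUnitNormal (ψ : ℝ × ℝ → ℝ) (p n : ℝ × ℝ) : Prop :=
  n.1 ^ 2 + n.2 ^ 2 = 1 ∧
    ∃ φ : ℝ × ℝ → ℝ, ContDiffAt ℝ 1 φ p ∧
      (∀ᶠ q in 𝓝 p, (0 < φ q ↔ 0 < ψ q) ∧ (φ q < 0 ↔ ψ q < 0)) ∧
      ∀ v : ℝ × ℝ, fderiv ℝ φ p v = n.1 * v.1 + n.2 * v.2

/-- The functions that enter the elliptic interface problem on the rectangle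
`(l₁, l₂) × (l₃, l₄)`. The values of `a`, `f`, `u` on the interface, and of `normal` off it, play
no role. -/
structure InterfaceData where
  /-- left end of the `x`-interval -/
  l₁ : ℝ
  /-- right end of the `x`-interval -/
  l₂ : ℝ
  /-- left end of the `y`-interval -/
  l₃ : ℝ
  /-- right end of the `y`-interval -/
  l₄ : ℝ
  /-- level set function of the interface -/
  ψ : ℝ × ℝ → ℝ
  /-- unit normal vector field of the interface -/
  normal : ℝ × ℝ → ℝ × ℝ
  /-- coefficient of the elliptic operator -/
  a : ℝ × ℝ → ℝ
  /-- source term -/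
  f : ℝ × ℝ → ℝ
  /-- solution -/
  u : ℝ × ℝ → ℝ
  /-- jump of the solution -/
  gD : ℝ × ℝ → ℝ
  /-- jump of the flux -/
  gN : ℝ × ℝ → ℝ

namespace InterfaceData

variable (P : InterfaceData)

/-- The rectangle `Ω`. -/
def domain : Set (ℝ × ℝ) := Set.Ioo P.l₁ P.l₂ ×ˢ Set.Ioo P.l₃ P.l₄

/-- The interface `Γ_I`. -/
def interface : Set (ℝ × ℝ) := {p ∈ P.domain | P.ψ p = 0}

/-- The subregion `Ω⁺`. -/
def regionPlus : Set (ℝ × ℝ) := {p ∈ P.domain | 0 < P.ψ p}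

/-- The subregion `Ω⁻`. -/
def regionMinus : Set (ℝ × ℝ) := {p ∈ P.domain | P.ψ p < 0}

/-- `F_+^{(m,n)}` at a point `p` of the interface: the limit of `∂^{m+n} F / ∂x^m ∂y^n` at `p`
from within `Ω⁺`. -/
def derivPlus (F : ℝ × ℝ → ℝ) (p : ℝ × ℝ) (q : ℕ × ℕ) : ℝ := limFrom P.regionPlus (pderiv q F) p

/-- `F_-^{(m,n)}` at a point `p` of the interface: the limit of `∂^{m+n} F / ∂x^m ∂y^n` at `p`
from within `Ω⁻`. -/
def derivMinus (F : ℝ × ℝ → ℝ) (p : ℝ × ℝ) (q : ℕ × ℕ) : ℝ := limFrom P.regionMinus (pderiv q F) p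

/-- The jump `[F]` at a point `p` of the interface. -/
def jump (F : ℝ × ℝ → ℝ) (p : ℝ × ℝ) : ℝ := limFrom P.regionPlus F p - limFrom P.regionMinus F p

/-- The interface problem: `Γ_I` is a curve that separates `Ω⁺` from `Ω⁻`, the coefficient `a` is
positive up to the interface, `a`, `u`, `f` are piecewise smooth of orders `M`, `M + 1`, `M - 1`,
`-∇ · (a ∇u) = f` in `Ω ∖ Γ_I`, and `[u] = g_D`, `[a ∇u · n] = g_N` on `Γ_I`. No condition is
imposed on the outer boundary of `Ω`. -/
structure IsSolution (M : ℕ) : Prop where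
  continuousOn_ψ : ContinuousOn P.ψ P.domain
  normal_spec : ∀ p ∈ P.interface, IsUnitNormal P.ψ p (P.normal p)
  a_pos : ∀ p ∈ P.domain \ P.interface, 0 < P.a p
  a_pos_interface : ∀ p ∈ P.interface,
    0 < limFrom P.regionPlus P.a p ∧ 0 < limFrom P.regionMinus P.a p
  a_plus : UniformlySmoothOn M P.a P.regionPlus
  a_minus : UniformlySmoothOn M P.a P.regionMinus
  u_plus : UniformlySmoothOn (M + 1) P.u P.regionPlus
  u_minus : UniformlySmoothOn (M + 1) P.u P.regionMinus
  f_plus : UniformlySmoothOn (M - 1) P.f P.regionPlus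
  f_minus : UniformlySmoothOn (M - 1) P.f P.regionMinus
  pde : ∀ p ∈ P.domain \ P.interface,
    -(partialX (fun z => P.a z * partialX P.u z) p
      + partialY (fun z => P.a z * partialY P.u z) p) = P.f p
  jump_u : ∀ p ∈ P.interface, P.jump P.u p = P.gD p
  jump_flux : ∀ p ∈ P.interface,
    P.jump (fun z => P.a z *
      (partialX P.u z * (P.normal p).1 + partialY P.u z * (P.normal p).2)) p = P.gN p

/-- `t ↦ (x* + r t, y* + s t)` is a regular parametrization, of class `C^{M+1}`, of the interface
near its point `p = (x*, y*)`, which has the parameter `t = 0`. -/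
def IsLocalParam (M : ℕ) (p : ℝ × ℝ) (r s : ℝ → ℝ) : Prop :=
  r 0 = 0 ∧ s 0 = 0 ∧ ∃ ε > 0,
    ContDiffOn ℝ (M + 1 : ℕ) r (Set.Ioo (-ε) ε) ∧ ContDiffOn ℝ (M + 1 : ℕ) s (Set.Ioo (-ε) ε) ∧
    ∀ t ∈ Set.Ioo (-ε) ε, 0 < deriv r t ^ 2 + deriv s t ^ 2 ∧ (p.1 + r t, p.2 + s t) ∈ P.interface

/-- The sign `±1` for which the unit normal at `p` is `±(s'(0), -r'(0)) / √(r'(0)² + s'(0)²)`: it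
is `1` if `Ω⁺` lies to the right of the parametrized curve and `-1` if it lies to the left. -/
def orientation (p : ℝ × ℝ) (r s : ℝ → ℝ) : ℝ :=
  Real.sign ((P.normal p).1 * deriv s 0 - (P.normal p).2 * deriv r 0)

end InterfaceData

/-! ### The data on which the transmission coefficients depend -/

/-- Possible values of `r^{(k)}(0)`, `s^{(k)}(0)` for `k = 0, …, M + 1` and of `a_±^{(m,n)}` for
`(m, n) ∈ Λ_M`. -/
structure Jet (M : ℕ) where
  /-- derivatives of `r` -/
  r : Fin (M + 2) → ℝ
  /-- derivatives of `s` -/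
  s : Fin (M + 2) → ℝ
  /-- derivatives of the coefficient on the positive side -/
  aPlus : {q // q ∈ Lam M} → ℝ
  /-- derivatives of the coefficient on the negative side -/
  aMinus : {q // q ∈ Lam M} → ℝ

/-- The index `(0, 0) ∈ Λ_M`. -/
def origin (M : ℕ) : {q // q ∈ Lam M} := ⟨(0, 0), mem_Lam.2 (Nat.zero_le _)⟩

/-- The values for an actual problem, a base point and a parametrization. -/
def InterfaceData.jet (P : InterfaceData) (M : ℕ) (p : ℝ × ℝ) (r s : ℝ → ℝ) : Jet M where
  r k := iteratedDeriv k r 0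
  s k := iteratedDeriv k s 0
  aPlus q := P.derivPlus P.a p q
  aMinus q := P.derivMinus P.a p q

end EllipticInterface

end

noncomputable section

namespace EllipticInterface

/-! ### Arrays of derivatives -/

/-! Differentiating the two jump conditions along the interface, and the differential equation on
both sides of it, gives finitely many linear relations at the base point between the one-sided
derivatives of u and f and the derivatives of g_D and g_N. Their coefficients involve only the jets
of the curve and of a. So the theorem splits into linear algebra on the space of arrays that satisfy
these relations (`Transmits`) and the analytic fact that solutions satisfy them
(`IsSolution.transmits`).

Algebra. Fix an order K ≥ 1 and suppose that the data, and all derivatives of u on both sides of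
orders 1 to K - 1, vanish. Then the elliptic equation reduces in order K to Laplace's equation, so
the derivatives of order K on each side are those of a harmonic polynomial and depend on two
numbers, the entries (0, K) and (1, K - 1). Under ∂/∂y ↦ 1 and ∂/∂x ↦ i, the tangential derivative
r'∂/∂x + s'∂/∂y becomes multiplication by z = s' + ir', and the conormal derivative s'∂/∂x - r'∂/∂y
becomes multiplication by iz. The two jump conditions of order K therefore compare the two
coordinates after the similarity given by z^K, the second coordinate being weighted by a on either
side. This system is invertible because z ≠ 0 and a is nonzero; `topCoeff` is its solution.
Induction on K shows that without lower order data the lower derivatives of u on the negative side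
vanish as well (`Transmits.uMinus_eq_zero`). The remaining coefficients need no computation: a
linear functional that vanishes on the common kernel of finitely many functionals is a combination
of them (`exists_transmission_coeffs`).

Analysis. The one-sided limits must obey the chain rule along the interface. For this the curve is
pushed slightly into each region, where the ordinary chain rule holds, and the displacement tends to
zero; uniform continuity makes the convergence uniform (`Pushes.hasDerivAt`). The orientation sign
is shown to be the same at nearby points, so that the flux condition, multiplied by the sign and the
speed of the curve, can be differentiated. -/

/-- The shift `(m, n) ↦ (m + 1, n)` of an array of derivatives. -/
def shiftX : (ℕ × ℕ → ℝ) →ₗ[ℝ] (ℕ × ℕ → ℝ) := LinearMap.funLeft ℝ ℝ fun q => (q.1 + 1, q.2)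

/-- The shift `(m, n) ↦ (m, n + 1)` of an array of derivatives. -/
def shiftY : (ℕ × ℕ → ℝ) →ₗ[ℝ] (ℕ × ℕ → ℝ) := LinearMap.funLeft ℝ ℝ fun q => (q.1, q.2 + 1)

@[simp] theorem shiftX_apply (G : ℕ × ℕ → ℝ) (q : ℕ × ℕ) : shiftX G q = G (q.1 + 1, q.2) := rfl

@[simp] theorem shiftY_apply (G : ℕ × ℕ → ℝ) (q : ℕ × ℕ) : shiftY G q = G (q.1, q.2 + 1) := rfl

/-- The `k`-th derivatives at `t = 0` of the functions `t ↦ ∂^q G (r t, s t)`, in terms of the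
derivatives of `r`, `s` and `G` at the origin. -/
def curveDeriv (r s : ℕ → ℝ) : ℕ → ((ℕ × ℕ → ℝ) →ₗ[ℝ] (ℕ × ℕ → ℝ))
  | 0 => LinearMap.id
  -- One differentiation gives r' ∂G/∂x + s' ∂G/∂y; the other k fall on these two products by the
  -- Leibniz rule.
  | k + 1 => ∑ i : Fin (k + 1), (k.choose i : ℝ) •
      (r (i + 1) • shiftX ∘ₗ curveDeriv r s (k - i) + s (i + 1) • shiftY ∘ₗ curveDeriv r s (k - i))
termination_by k => k

theorem curveDeriv_zero (r s : ℕ → ℝ) (G : ℕ × ℕ → ℝ) : curveDeriv r s 0 G = G := by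
  rw [curveDeriv]; rfl

theorem curveDeriv_succ (r s : ℕ → ℝ) (k : ℕ) (G : ℕ × ℕ → ℝ) (q : ℕ × ℕ) :
    curveDeriv r s (k + 1) G q = ∑ i ∈ Finset.range (k + 1), (k.choose i : ℝ) *
      (r (i + 1) * curveDeriv r s (k - i) G (q.1 + 1, q.2)
        + s (i + 1) * curveDeriv r s (k - i) G (q.1, q.2 + 1)) := by
  rw [curveDeriv, ← Fin.sum_univ_eq_sum_range (fun i => (k.choose i : ℝ) *
      (r (i + 1) * curveDeriv r s (k - i) G (q.1 + 1, q.2)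
        + s (i + 1) * curveDeriv r s (k - i) G (q.1, q.2 + 1)))]
  simp [mul_add]

/-- The Leibniz product of two sequences of derivatives. -/
def leibniz (x : ℕ → ℝ) : (ℕ → ℝ) →ₗ[ℝ] (ℕ → ℝ) :=
  LinearMap.pi fun k => ∑ i ∈ Finset.range (k + 1), ((k.choose i : ℝ) * x i) • LinearMap.proj (k - i)

theorem leibniz_apply (x y : ℕ → ℝ) (k : ℕ) :
    leibniz x y k = ∑ i ∈ Finset.range (k + 1), (k.choose i : ℝ) * x i * y (k - i) := by
  simp [leibniz]

/-- The Leibniz product of two arrays of derivatives. -/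
def leibniz₂ (A : ℕ × ℕ → ℝ) : (ℕ × ℕ → ℝ) →ₗ[ℝ] (ℕ × ℕ → ℝ) :=
  LinearMap.pi fun q => ∑ i ∈ Finset.range (q.1 + 1), ∑ j ∈ Finset.range (q.2 + 1),
    ((q.1.choose i : ℝ) * q.2.choose j * A (i, j)) • LinearMap.proj (q.1 - i, q.2 - j)

theorem leibniz₂_apply (A B : ℕ × ℕ → ℝ) (q : ℕ × ℕ) :
    leibniz₂ A B q = ∑ i ∈ Finset.range (q.1 + 1), ∑ j ∈ Finset.range (q.2 + 1),
      (q.1.choose i : ℝ) * q.2.choose j * A (i, j) * B (q.1 - i, q.2 - j) := by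
  simp [leibniz₂]

/-- The derivatives at `t = 0` of `t ↦ ∂^q G (r t, s t)`. -/
def traceJet (r s : ℕ → ℝ) (q : ℕ × ℕ) : (ℕ × ℕ → ℝ) →ₗ[ℝ] (ℕ → ℝ) :=
  LinearMap.pi fun k => LinearMap.proj q ∘ₗ curveDeriv r s k

theorem traceJet_apply (r s : ℕ → ℝ) (q : ℕ × ℕ) (G : ℕ × ℕ → ℝ) (k : ℕ) :
    traceJet r s q G k = curveDeriv r s k G q := rfl

/-- The derivatives at `t = 0` of the flux `A (∂U/∂x s' - ∂U/∂y r')` along the curve `(r, s)`. -/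
def fluxJet (r s : ℕ → ℝ) (A : ℕ × ℕ → ℝ) : (ℕ × ℕ → ℝ) →ₗ[ℝ] (ℕ → ℝ) :=
  leibniz (traceJet r s (0, 0) A) ∘ₗ
    (leibniz (fun k => s (k + 1)) ∘ₗ traceJet r s (1, 0)
      - leibniz (fun k => r (k + 1)) ∘ₗ traceJet r s (0, 1))

theorem fluxJet_apply (r s : ℕ → ℝ) (A U : ℕ × ℕ → ℝ) :
    fluxJet r s A U = leibniz (traceJet r s (0, 0) A)
      (leibniz (fun k => s (k + 1)) (traceJet r s (1, 0) U)
        - leibniz (fun k => r (k + 1)) (traceJet r s (0, 1) U)) := rfl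

/-- The derivatives of `∇ · (A ∇U)`. -/
def ellipticJet (A : ℕ × ℕ → ℝ) : (ℕ × ℕ → ℝ) →ₗ[ℝ] (ℕ × ℕ → ℝ) :=
  shiftX ∘ₗ leibniz₂ A ∘ₗ shiftX + shiftY ∘ₗ leibniz₂ A ∘ₗ shiftY

theorem ellipticJet_apply (A U : ℕ × ℕ → ℝ) (q : ℕ × ℕ) :
    ellipticJet A U q = leibniz₂ A (shiftX U) (q.1 + 1, q.2)
      + leibniz₂ A (shiftY U) (q.1, q.2 + 1) := rfl

/-! ### Terms of highest order -/

theorem leibniz_eq_single {x y : ℕ → ℝ} {k : ℕ} (h : ∀ j < k, y j = 0) :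
    leibniz x y k = x 0 * y k := by
  rw [leibniz_apply, Finset.sum_range_succ', Finset.sum_eq_zero]
  · simp
  · intro i hi
    rw [Finset.mem_range] at hi
    rw [h _ (by omega), mul_zero]

theorem leibniz_eq_zero {x y : ℕ → ℝ} {k : ℕ} (h : ∀ j ≤ k, y j = 0) : leibniz x y k = 0 := by
  rw [leibniz_eq_single fun j hj => h j hj.le, h k le_rfl, mul_zero]

theorem leibniz₂_eq_single {A B : ℕ × ℕ → ℝ} {q : ℕ × ℕ}
    (h : ∀ q' : ℕ × ℕ, q'.1 + q'.2 < q.1 + q.2 → B q' = 0) :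
    leibniz₂ A B q = A (0, 0) * B q := by
  rw [leibniz₂_apply, Finset.sum_range_succ', Finset.sum_eq_zero, Finset.sum_range_succ',
    Finset.sum_eq_zero]
  · simp
  · intro j hj
    rw [Finset.mem_range] at hj
    rw [h _ (by simp only; omega), mul_zero]
  · intro i hi
    rw [Finset.mem_range] at hi
    refine Finset.sum_eq_zero fun j hj => ?_
    rw [h _ (by simp only; omega), mul_zero]

/-- Each differentiation along the curve raises the order of a partial derivative by at most one, so
only orders from |q| to |q| + k can occur. -/
theorem curveDeriv_eq_zero {r s : ℕ → ℝ} {G : ℕ × ℕ → ℝ} (k : ℕ) :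
    ∀ q : ℕ × ℕ, (∀ q' : ℕ × ℕ, q.1 + q.2 ≤ q'.1 + q'.2 → q'.1 + q'.2 ≤ q.1 + q.2 + k → G q' = 0) →
      curveDeriv r s k G q = 0 := by
  induction k using Nat.strong_induction_on with
  | _ k ih =>
    intro q h
    cases k with
    | zero => rw [curveDeriv_zero, h q le_rfl le_rfl]
    | succ k =>
      rw [curveDeriv_succ]
      refine Finset.sum_eq_zero fun i hi => ?_
      rw [ih (k - i) (by omega) _ fun q' h1 h2 => h q' (by simp only at h1; omega)
          (by simp only at h2; omega),
        ih (k - i) (by omega) _ fun q' h1 h2 => h q' (by simp only at h1; omega)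
          (by simp only at h2; omega)]
      simp

/-- If `G` is harmonic in order `K`, the derivatives of order `K` are determined by those with
respect to `y` and by those with one derivative with respect to `x`. -/
theorem harmonic_eq {G : ℕ × ℕ → ℝ} {K : ℕ}
    (hG : ∀ i j : ℕ, i + j + 2 = K → G (i + 2, j) = -G (i, j + 2)) :
    ∀ i j : ℕ, i + j = K →
      G (i, j) = (Complex.I ^ i).re * G (0, K) + (Complex.I ^ i).im * G (1, K - 1) := by
  intro i
  induction i using Nat.strong_induction_on with
  | _ i ih =>
    intro j hij
    match i with
    | 0 => simp_all
    | 1 => simp [← hij]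
    | i + 2 =>
      -- Trading two x-derivatives for two y-derivatives costs a sign, which is i² = -1: ∂/∂x acts
      -- as multiplication by i.
      rw [hG i j (by omega), ih i (by omega) (j + 2) (by omega), pow_add, Complex.I_sq]
      simp
      ring

/-- The terms of order `K` in a derivative along a curve, if the derivatives of lower order
vanish. -/
theorem curveDeriv_top {r s : ℕ → ℝ} {G : ℕ × ℕ → ℝ} {K : ℕ}
    (hG : ∀ i j : ℕ, i + j + 2 = K → G (i + 2, j) = -G (i, j + 2)) (k : ℕ) :
    ∀ q : ℕ × ℕ, q.1 + q.2 + k = K →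
      (∀ q' : ℕ × ℕ, q.1 + q.2 < q'.1 + q'.2 → q'.1 + q'.2 < K → G q' = 0) →
      curveDeriv r s k G q
        = (Complex.mk (s 1) (r 1) ^ k * Complex.I ^ q.1).re * G (0, K)
          + (Complex.mk (s 1) (r 1) ^ k * Complex.I ^ q.1).im * G (1, K - 1) := by
  induction k with
  | zero =>
    intro q hq _
    rw [curveDeriv_zero, pow_zero, one_mul]
    exact harmonic_eq hG q.1 q.2 hq
  | succ k ih =>
    intro q hq h
    -- Only the summand i = 0 reaches order K. When i ≥ 1, a derivative has been spent on r' or s',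
    -- and the partial derivatives that remain have order below K and vanish.
    rw [curveDeriv_succ, Finset.sum_range_succ', Finset.sum_eq_zero]
    · rw [Nat.sub_zero, ih (q.1 + 1, q.2) (by simp only; omega)
          fun q' h1 h2 => h q' (by simp only at h1; omega) h2,
        ih (q.1, q.2 + 1) (by simp only; omega)
          fun q' h1 h2 => h q' (by simp only at h1; omega) h2]
      have : Complex.mk (s 1) (r 1) ^ (k + 1) * Complex.I ^ q.1
          = s 1 * (Complex.mk (s 1) (r 1) ^ k * Complex.I ^ q.1)
            + r 1 * (Complex.mk (s 1) (r 1) ^ k * Complex.I ^ (q.1 + 1)) := by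
        have h1 : Complex.mk (s 1) (r 1) = s 1 + r 1 * Complex.I := by
          apply Complex.ext <;> simp
        rw [pow_succ _ k]
        nth_rewrite 2 [h1]
        ring
      rw [this]
      simp only [Complex.add_re, Complex.add_im, Complex.re_ofReal_mul, Complex.im_ofReal_mul,
        Nat.choose_zero_right, Nat.cast_one]
      ring
    · intro i hi
      rw [Finset.mem_range] at hi
      rw [curveDeriv_eq_zero, curveDeriv_eq_zero]
      · simp
      · intro q' h1 h2
        simp only at h1 h2
        exact h q' (by omega) (by omega)
      · intro q' h1 h2
        simp only at h1 h2
        exact h q' (by omega) (by omega)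

/-- All K derivatives must fall on the gradient of U, since otherwise a derivative of U of order at
most K survives. The conormal derivative contributes s'i - r' = iz, so the entries are the real and
imaginary parts of i z^(K+1). -/
theorem fluxJet_top {r s : ℕ → ℝ} {A U : ℕ × ℕ → ℝ} {K : ℕ}
    (hU : ∀ i j : ℕ, i + j + 2 = K + 1 → U (i + 2, j) = -U (i, j + 2))
    (h : ∀ q : ℕ × ℕ, 0 < q.1 + q.2 → q.1 + q.2 < K + 1 → U q = 0) :
    fluxJet r s A U K = A (0, 0) * (-(Complex.mk (s 1) (r 1) ^ (K + 1)).im * U (0, K + 1)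
      + (Complex.mk (s 1) (r 1) ^ (K + 1)).re * U (1, K)) := by
  have lower : ∀ q : ℕ × ℕ, q.1 + q.2 = 1 → ∀ j < K, traceJet r s q U j = 0 := by
    intro q hq j hj
    rw [traceJet_apply]
    exact curveDeriv_eq_zero _ _ fun q' h1 h2 => h q' (by omega) (by omega)
  have hx := lower (1, 0) rfl
  have hy := lower (0, 1) rfl
  rw [fluxJet_apply, leibniz_eq_single]
  · rw [Pi.sub_apply, leibniz_eq_single hx, leibniz_eq_single hy, traceJet_apply, traceJet_apply,
      traceJet_apply, curveDeriv_zero,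
      curveDeriv_top hU K (1, 0) (by simp only; omega) fun q' h1 h2 => h q' (by simp only at h1; omega) h2,
      curveDeriv_top hU K (0, 1) (by simp only; omega) fun q' h1 h2 => h q' (by simp only at h1; omega) h2,
      pow_succ (Complex.mk (s 1) (r 1)) K]
    simp only [pow_zero, pow_one, mul_one, Complex.mul_re, Complex.mul_im, Complex.I_re,
      Complex.I_im, zero_add, add_tsub_cancel_right]
    ring
  · intro j hj
    rw [Pi.sub_apply, leibniz_eq_zero fun i hi => hx i (by omega),
      leibniz_eq_zero fun i hi => hy i (by omega), sub_zero]

/-- The elliptic equation makes the derivatives of highest order harmonic. -/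
theorem harmonic_of_ellipticJet {A U : ℕ × ℕ → ℝ} (hA : A (0, 0) ≠ 0) {i j : ℕ}
    (h0 : ellipticJet A U (i, j) = 0)
    (h : ∀ q : ℕ × ℕ, 0 < q.1 + q.2 → q.1 + q.2 < i + j + 2 → U q = 0) :
    U (i + 2, j) = -U (i, j + 2) := by
  rw [ellipticJet_apply, leibniz₂_eq_single, leibniz₂_eq_single, ← mul_add] at h0
  · have := (mul_eq_zero.1 h0).resolve_left hA
    simp at this
    linarith
  · intro q hq
    rw [shiftY_apply]
    simp only at hq
    exact h _ (by simp) (by simp only; omega)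
  · intro q hq
    rw [shiftX_apply]
    simp only at hq
    exact h _ (by simp only; omega) (by simp only; omega)

/-- Order by order, vanishing lower derivatives turn the elliptic equation into Laplace's equation,
and a harmonic array vanishes in a given order once its two basic entries do. Order zero is left out
because the equation involves only derivatives of U. -/
theorem eq_zero_of_ellipticJet {A U : ℕ × ℕ → ℝ} (hA : A (0, 0) ≠ 0) {K : ℕ}
    (h0 : ∀ i j : ℕ, i + j + 2 ≤ K → ellipticJet A U (i, j) = 0)
    (h : ∀ q : ℕ × ℕ, q.1 ≤ 1 → 0 < q.1 + q.2 → q.1 + q.2 ≤ K → U q = 0) (k : ℕ) :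
    k ≤ K → ∀ q : ℕ × ℕ, 0 < q.1 + q.2 → q.1 + q.2 = k → U q = 0 := by
  induction k using Nat.strong_induction_on with
  | _ k ih =>
    intro hk q hq hqk
    rw [show q = (q.1, q.2) from rfl, harmonic_eq (G := U) (K := k) _ q.1 q.2 hqk,
      h (0, k) (by simp) (by simp only; omega) (by simp only; omega),
      h (1, k - 1) le_rfl (by simp only; omega) (by simp only; omega)]
    · simp
    · intro i j hij
      exact harmonic_of_ellipticJet hA (h0 i j (by omega))
        fun q' h1 h2 => ih (q'.1 + q'.2) (by omega) (by omega) q' h1 rfl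

/-! ### The transmission relations between the derivatives at a point -/

/-- The derivatives of `r`, continued by zero. -/
def Jet.rSeq {M : ℕ} (J : Jet M) (k : ℕ) : ℝ := if h : k < M + 2 then J.r ⟨k, h⟩ else 0

/-- The derivatives of `s`, continued by zero. -/
def Jet.sSeq {M : ℕ} (J : Jet M) (k : ℕ) : ℝ := if h : k < M + 2 then J.s ⟨k, h⟩ else 0

/-- The derivatives of the coefficient on the positive side, continued by zero. -/
def Jet.coeffPlus {M : ℕ} (J : Jet M) (q : ℕ × ℕ) : ℝ := if h : q ∈ Lam M then J.aPlus ⟨q, h⟩ else 0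

/-- The derivatives of the coefficient on the negative side, continued by zero. -/
def Jet.coeffMinus {M : ℕ} (J : Jet M) (q : ℕ × ℕ) : ℝ :=
  if h : q ∈ Lam M then J.aMinus ⟨q, h⟩ else 0

theorem Jet.coeffPlus_zero {M : ℕ} (J : Jet M) : J.coeffPlus (0, 0) = J.aPlus (origin M) :=
  dif_pos _

theorem Jet.coeffMinus_zero {M : ℕ} (J : Jet M) : J.coeffMinus (0, 0) = J.aMinus (origin M) :=
  dif_pos _

/-- `v` is the sequence of derivatives, up to order `K`, of the speed of the curve `(r, s)`. -/
def IsSpeedJet (r s : ℕ → ℝ) (K : ℕ) (v : ℕ → ℝ) : Prop :=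
  0 < v 0 ∧ ∀ k ≤ K, leibniz v v k
    = leibniz (fun i => r (i + 1)) (fun i => r (i + 1)) k
      + leibniz (fun i => s (i + 1)) (fun i => s (i + 1)) k

/-- In order k ≥ 1 the unknown v k enters v² only through the two end terms 2 (v 0)(v k), and v 0 >
0; in order zero positivity selects the square root. Thus the derivatives of the speed are functions
of the jet of the curve. -/
theorem IsSpeedJet.unique {r s : ℕ → ℝ} {K : ℕ} {v w : ℕ → ℝ} (hv : IsSpeedJet r s K v)
    (hw : IsSpeedJet r s K w) (k : ℕ) : k ≤ K → v k = w k := by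
  induction k using Nat.strong_induction_on with
  | _ k ih =>
    intro hk
    have h := (hv.2 k hk).trans (hw.2 k hk).symm
    rw [leibniz_apply, leibniz_apply] at h
    cases k with
    | zero =>
      simp only [zero_add, Finset.sum_range_one, Nat.choose_self, Nat.cast_one, one_mul,
        Nat.sub_self] at h
      nlinarith [hv.1, hw.1]
    | succ k =>
      rw [Finset.sum_range_succ, Finset.sum_range_succ _ (k + 1), Finset.sum_range_succ',
        Finset.sum_range_succ' _ k] at h
      have h0 := ih 0 (by omega) (by omega)
      rw [Finset.sum_congr rfl (g := fun i => ((k + 1).choose (i + 1) : ℝ) * w (i + 1)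
        * w (k + 1 - (i + 1)))] at h
      · simp only [Nat.choose_zero_right, Nat.choose_self, Nat.cast_one, one_mul, Nat.sub_zero,
          Nat.sub_self, h0] at h
        have := hw.1
        have h2 : 2 * w 0 * (v (k + 1) - w (k + 1)) = 0 := by linarith
        have := (mul_eq_zero.1 h2).resolve_left (by positivity)
        linarith
      · intro i hi
        rw [Finset.mem_range] at hi
        rw [ih (i + 1) (by omega) (by omega), ih (k + 1 - (i + 1)) (by omega) (by omega)]

open Classical in
/-- The derivatives of the speed of the curve `(r, s)`. -/
def speedJet (r s : ℕ → ℝ) (K : ℕ) : ℕ → ℝ :=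
  -- The default is harmless: the algebraic argument uses no property of this sequence, and an
  -- actual parametrization supplies a speed jet.
  if h : ∃ v, IsSpeedJet r s K v then h.choose else 0

theorem IsSpeedJet.eq_speedJet {r s : ℕ → ℝ} {K : ℕ} {v : ℕ → ℝ} (hv : IsSpeedJet r s K v)
    {k : ℕ} (hk : k ≤ K) : speedJet r s K k = v k := by
  have h : ∃ v, IsSpeedJet r s K v := ⟨v, hv⟩
  rw [speedJet, dif_pos h]
  exact h.choose_spec.unique hv k hk

/-- The space of arrays of derivatives at a point of the interface: of the solution on the positive
side (`0`) and on the negative side (`1`), of the source term on the positive side (`2`) and on the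
negative side (`3`), of the jump of the solution (`4`), and of the jump of the flux across the curve
in its given orientation (`5`). -/
abbrev ArraySpace : Type := Fin 6 → ℕ × ℕ → ℝ

/-- The entry `q` of the `i`-th array. -/
def entry (i : Fin 6) (q : ℕ × ℕ) : ArraySpace →ₗ[ℝ] ℝ where
  toFun x := x i q
  map_add' _ _ := rfl
  map_smul' _ _ := rfl

@[simp] theorem entry_apply (i : Fin 6) (q : ℕ × ℕ) (x : ArraySpace) : entry i q x = x i q := rfl

/-- The relations that the interface problem imposes on the derivatives at a point. -/
structure Transmits {M : ℕ} (J : Jet M) (x : ArraySpace) : Prop where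
  pde_plus : ∀ q : ℕ × ℕ, q.1 + q.2 + 1 ≤ M → ellipticJet J.coeffPlus (x 0) q = -x 2 q
  pde_minus : ∀ q : ℕ × ℕ, q.1 + q.2 + 1 ≤ M → ellipticJet J.coeffMinus (x 1) q = -x 3 q
  jump : ∀ k ≤ M + 1, traceJet J.rSeq J.sSeq (0, 0) (x 0) k
    - traceJet J.rSeq J.sSeq (0, 0) (x 1) k = traceJet J.rSeq J.sSeq (0, 0) (x 4) k
  flux : ∀ k ≤ M, fluxJet J.rSeq J.sSeq J.coeffPlus (x 0) k
    - fluxJet J.rSeq J.sSeq J.coeffMinus (x 1) k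
      = leibniz (speedJet J.rSeq J.sSeq M) (traceJet J.rSeq J.sSeq (0, 0) (x 5)) k

/-- The arrays of derivatives that satisfy the transmission relations. -/
def transmissionSpace {M : ℕ} (J : Jet M) : Submodule ℝ ArraySpace where
  carrier := {x | Transmits J x}
  zero_mem' := by
    constructor <;> intros <;> simp
  add_mem' := by
    intro x y hx hy
    constructor
    · intro q hq
      simp only [Pi.add_apply, map_add, hx.pde_plus q hq, hy.pde_plus q hq]
      ring
    · intro q hq
      simp only [Pi.add_apply, map_add, hx.pde_minus q hq, hy.pde_minus q hq]
      ring
    · intro k hk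
      simp only [Pi.add_apply, map_add, ← hx.jump k hk, ← hy.jump k hk]
      ring
    · intro k hk
      simp only [Pi.add_apply, map_add, ← hx.flux k hk, ← hy.flux k hk]
      ring
  smul_mem' := by
    intro c x hx
    constructor
    · intro q hq
      simp only [Pi.smul_apply, map_smul, hx.pde_plus q hq, smul_neg]
    · intro q hq
      simp only [Pi.smul_apply, map_smul, hx.pde_minus q hq, smul_neg]
    · intro k hk
      simp only [Pi.smul_apply, map_smul, ← hx.jump k hk, smul_sub]
    · intro k hk
      simp only [Pi.smul_apply, map_smul, ← hx.flux k hk, smul_sub]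

/-- The data of order `K` vanish, except for the leading derivatives of the solution on the positive
side. -/
structure Homogeneous (M K : ℕ) (x : ArraySpace) : Prop where
  -- The value of u itself is not required to vanish. It enters only the undifferentiated jump
  -- condition, which is why its coefficient is zero in all formulas of positive order.
  uPlus : ∀ q : ℕ × ℕ, q.1 ≤ 1 → 0 < q.1 + q.2 → q.1 + q.2 < K → x 0 q = 0
  fPlus : ∀ q : ℕ × ℕ, q.1 + q.2 ≤ M - 1 → x 2 q = 0
  fMinus : ∀ q : ℕ × ℕ, q.1 + q.2 ≤ M - 1 → x 3 q = 0
  gD : ∀ q : ℕ × ℕ, q.1 + q.2 ≤ M + 1 → x 4 q = 0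
  gN : ∀ q : ℕ × ℕ, q.1 + q.2 ≤ M → x 5 q = 0

/-- The jet has a regular curve and positive coefficients. -/
structure Jet.Regular {M : ℕ} (J : Jet M) : Prop where
  curve : J.sSeq 1 ^ 2 + J.rSeq 1 ^ 2 ≠ 0
  plus_ne : J.coeffPlus (0, 0) ≠ 0
  minus_ne : J.coeffMinus (0, 0) ≠ 0

section

variable {M : ℕ} {J : Jet M} {x : ArraySpace}

/-- The two conditions on the derivatives of order `K` in the absence of lower order data. -/
theorem Transmits.top_relations (hx : Transmits J x) (hJ : J.Regular) {K : ℕ} (hKM : K ≤ M)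
    (h : Homogeneous M (K + 1) x)
    (hplus : ∀ q : ℕ × ℕ, 0 < q.1 + q.2 → q.1 + q.2 < K + 1 → x 0 q = 0)
    (hminus : ∀ q : ℕ × ℕ, 0 < q.1 + q.2 → q.1 + q.2 < K + 1 → x 1 q = 0) :
    (Complex.mk (J.sSeq 1) (J.rSeq 1) ^ (K + 1)).re * x 0 (0, K + 1)
        + (Complex.mk (J.sSeq 1) (J.rSeq 1) ^ (K + 1)).im * x 0 (1, K)
      = (Complex.mk (J.sSeq 1) (J.rSeq 1) ^ (K + 1)).re * x 1 (0, K + 1)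
        + (Complex.mk (J.sSeq 1) (J.rSeq 1) ^ (K + 1)).im * x 1 (1, K) ∧
    J.coeffPlus (0, 0) * (-(Complex.mk (J.sSeq 1) (J.rSeq 1) ^ (K + 1)).im * x 0 (0, K + 1)
        + (Complex.mk (J.sSeq 1) (J.rSeq 1) ^ (K + 1)).re * x 0 (1, K))
      = J.coeffMinus (0, 0) * (-(Complex.mk (J.sSeq 1) (J.rSeq 1) ^ (K + 1)).im * x 1 (0, K + 1)
        + (Complex.mk (J.sSeq 1) (J.rSeq 1) ^ (K + 1)).re * x 1 (1, K)) := by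
  have hp : ∀ i j : ℕ, i + j + 2 = K + 1 → x 0 (i + 2, j) = -x 0 (i, j + 2) := by
    intro i j hij
    refine harmonic_of_ellipticJet hJ.plus_ne ?_ fun q h1 h2 => hplus q h1 (by omega)
    rw [hx.pde_plus _ (by simp only; omega), h.fPlus _ (by simp only; omega), neg_zero]
  have hm : ∀ i j : ℕ, i + j + 2 = K + 1 → x 1 (i + 2, j) = -x 1 (i, j + 2) := by
    intro i j hij
    refine harmonic_of_ellipticJet hJ.minus_ne ?_ fun q h1 h2 => hminus q h1 (by omega)
    rw [hx.pde_minus _ (by simp only; omega), h.fMinus _ (by simp only; omega), neg_zero]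
  constructor
  · have hj := hx.jump (K + 1) (by omega)
    simp only [traceJet_apply] at hj
    rw [curveDeriv_top hp (K + 1) (0, 0) (by simp) fun q h1 h2 => hplus q h1 h2,
      curveDeriv_top hm (K + 1) (0, 0) (by simp) fun q h1 h2 => hminus q h1 h2,
      curveDeriv_eq_zero _ _ fun q h1 h2 => h.gD q (by simp only at h2; omega)] at hj
    simpa [sub_eq_zero] using hj
  · have hf := hx.flux K hKM
    rw [fluxJet_top hp hplus, fluxJet_top hm hminus, leibniz_eq_zero, sub_eq_zero] at hf
    · exact hf
    · intro j hj
      rw [traceJet_apply]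
      exact curveDeriv_eq_zero _ _ fun q h1 h2 => h.gN q (by simp only at h2; omega)

end

/-! ### The 2 × 2 system for the leading derivatives -/

/-- The coefficient of `u_+^{q}` in the formula for `u_-^{q'}`, if both derivatives have order `K`.
The curve has the tangent vector `(r, s)`, and `κ` is the ratio of the two coefficients. -/
def topCoeff (r s κ : ℝ) (K : ℕ) (q' q : ℕ × ℕ) : ℝ :=
  let z := Complex.mk s r ^ K
  ((if q'.1 = 0 then z.re else z.im) * (if q.1 = 0 then z.re else z.im)
    + κ * (if q'.1 = 0 then -z.im else z.re) * (if q.1 = 0 then -z.im else z.re))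
    / (z.re ^ 2 + z.im ^ 2)

/-- With R the matrix with rows (Re z^K, Im z^K) and (-Im z^K, Re z^K), the hypotheses say R v =
diag(1, a/b) R u. Since R Rᵀ = |z^K|² I, the solution is v = Rᵀ diag(1, a/b) R u / |z^K|², whose
entries are the values of `topCoeff`. -/
theorem topCoeff_spec {r s a b : ℝ} (hrs : s ^ 2 + r ^ 2 ≠ 0) (hb : b ≠ 0) {K : ℕ}
    {u₀ u₁ v₀ v₁ : ℝ}
    (h1 : (Complex.mk s r ^ K).re * u₀ + (Complex.mk s r ^ K).im * u₁
      = (Complex.mk s r ^ K).re * v₀ + (Complex.mk s r ^ K).im * v₁)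
    (h2 : a * (-(Complex.mk s r ^ K).im * u₀ + (Complex.mk s r ^ K).re * u₁)
      = b * (-(Complex.mk s r ^ K).im * v₀ + (Complex.mk s r ^ K).re * v₁)) (m n n' l : ℕ)
    (hm : m ≤ 1) :
    (if m = 0 then v₀ else v₁)
      = topCoeff r s (a / b) K (m, l) (0, n) * u₀ + topCoeff r s (a / b) K (m, l) (1, n') * u₁ := by
  have hz : (Complex.mk s r ^ K).re ^ 2 + (Complex.mk s r ^ K).im ^ 2 ≠ 0 := by
    have h : Complex.normSq (Complex.mk s r ^ K) ≠ 0 := by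
      rw [map_pow]
      apply pow_ne_zero
      rw [Complex.normSq_apply]
      convert hrs using 1
      ring
    rw [Complex.normSq_apply] at h
    convert h using 1
    ring
  unfold topCoeff
  generalize Complex.mk s r ^ K = z at *
  interval_cases m
  · simp only [if_true, one_ne_zero, if_false]
    field_simp
    linear_combination (-b * z.re) * h1 + z.im * h2
  · simp only [if_true, one_ne_zero, if_false]
    field_simp
    linear_combination (-b * z.im) * h1 - z.re * h2

section

variable {M : ℕ} {J : Jet M} {x : ArraySpace}

theorem Transmits.uPlus_eq_zero (hx : Transmits J x) (hJ : J.Regular) {K : ℕ} (hKM : K ≤ M)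
    (h : Homogeneous M (K + 1) x) (q : ℕ × ℕ) (h1 : 0 < q.1 + q.2) (h2 : q.1 + q.2 < K + 1) :
    x 0 q = 0 := by
  refine eq_zero_of_ellipticJet (K := K) hJ.plus_ne (fun i j hij => ?_)
    (fun q' e1 e2 e3 => h.uPlus q' e1 e2 (by omega)) (q.1 + q.2) (by omega) q h1 rfl
  rw [hx.pde_plus _ (by simp only; omega), h.fPlus _ (by simp only; omega), neg_zero]

/-- Induction on the order: once the lower derivatives vanish on both sides, the 2 × 2 system with
zero right-hand side forces the two basic entries of the next order to vanish, and the elliptic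
equation gives the others. -/
theorem Transmits.uMinus_eq_zero (hx : Transmits J x) (hJ : J.Regular) (K : ℕ) (hKM : K ≤ M) :
    Homogeneous M (K + 1) x → ∀ q : ℕ × ℕ, 0 < q.1 + q.2 → q.1 + q.2 < K + 1 → x 1 q = 0 := by
  induction K with
  | zero => intro _ q _ _; omega
  | succ K ih =>
    intro h q h1 h2
    have h' : Homogeneous M (K + 1) x := ⟨fun q e1 e2 e3 => h.uPlus q e1 e2 (by omega), h.fPlus,
      h.fMinus, h.gD, h.gN⟩
    have low := ih (by omega) h'
    have top := hx.top_relations hJ (by omega) h' (hx.uPlus_eq_zero hJ (by omega) h') low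
    have t0 := topCoeff_spec hJ.curve hJ.minus_ne top.1 top.2 0 0 0 0 (by omega)
    have t1 := topCoeff_spec hJ.curve hJ.minus_ne top.1 top.2 1 0 0 0 (by omega)
    rw [h.uPlus (0, K + 1) (by simp) (by simp) (by simp only; omega),
      h.uPlus (1, K) (by simp) (by simp only; omega) (by simp only; omega)] at t0 t1
    simp at t0 t1
    refine eq_zero_of_ellipticJet (K := K + 1) hJ.minus_ne (fun i j hij => ?_) (fun q' e1 e2 e3 => ?_)
      (q.1 + q.2) (by omega) q h1 rfl
    · rw [hx.pde_minus _ (by simp only; omega), h.fMinus _ (by simp only; omega), neg_zero]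
    · rcases Nat.lt_or_eq_of_le e3 with e | e
      · exact low q' e2 e
      · obtain ⟨m, n⟩ := q'
        simp only at e e1
        interval_cases m
        · rw [show n = K + 1 by omega, t0]
        · rw [show n = K by omega, t1]

/-- The leading part of the transmission formula. -/
def topSum (J : Jet M) (q' : ℕ × ℕ) : ArraySpace →ₗ[ℝ] ℝ :=
  ∑ q ∈ LamV1 (M + 1) with q.1 + q.2 = q'.1 + q'.2,
    topCoeff (J.rSeq 1) (J.sSeq 1) (J.coeffPlus (0, 0) / J.coeffMinus (0, 0)) (q'.1 + q'.2) q' q • entry 0 q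

theorem topSum_apply (J : Jet M) (q' : ℕ × ℕ) (x : ArraySpace) :
    topSum J q' x = ∑ q ∈ LamV1 (M + 1) with q.1 + q.2 = q'.1 + q'.2,
      topCoeff (J.rSeq 1) (J.sSeq 1) (J.coeffPlus (0, 0) / J.coeffMinus (0, 0)) (q'.1 + q'.2) q' q
        * x 0 q := by
  simp [topSum]

theorem topCoeff_zero (r s κ : ℝ) : topCoeff r s κ 0 (0, 0) (0, 0) = 1 := by
  simp [topCoeff]

/-- With all lower order data removed, the 2 × 2 system is the whole formula. Order zero is
separate: there the jump condition alone gives equality of the two values. -/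
theorem Transmits.uMinus_eq_topSum (hx : Transmits J x) (hJ : J.Regular) {q' : ℕ × ℕ}
    (hq' : q' ∈ LamV1 (M + 1)) (h : Homogeneous M (q'.1 + q'.2) x) : x 1 q' = topSum J q' x := by
  obtain ⟨m, l⟩ := q'
  rw [mem_LamV1] at hq'
  simp only at hq' h
  rw [topSum_apply]
  rcases Nat.eq_zero_or_pos (m + l) with h0 | hpos
  · obtain ⟨rfl, rfl⟩ : m = 0 ∧ l = 0 := by omega
    rw [show (LamV1 (M + 1)).filter (fun q => q.1 + q.2 = ((0 : ℕ), (0 : ℕ)).1 + ((0 : ℕ), (0 : ℕ)).2)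
        = {(0, 0)} by
      ext ⟨i, j⟩
      simp only [Finset.mem_filter, mem_LamV1, Finset.mem_singleton, Prod.mk.injEq]
      omega]
    have hj := hx.jump 0 (by omega)
    simp only [traceJet_apply, curveDeriv_zero, h.gD (0, 0) (by simp)] at hj
    rw [Finset.sum_singleton, show ((0 : ℕ), (0 : ℕ)).1 + ((0 : ℕ), (0 : ℕ)).2 = 0 from rfl, topCoeff_zero,
      one_mul]
    linarith
  · obtain ⟨K, hK⟩ : ∃ K, m + l = K + 1 := ⟨m + l - 1, by omega⟩
    rw [hK] at h
    have top := hx.top_relations hJ (by omega) h (hx.uPlus_eq_zero hJ (by omega) h)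
      (hx.uMinus_eq_zero hJ K (by omega) h)
    have t := topCoeff_spec hJ.curve hJ.minus_ne top.1 top.2 m (K + 1) K l hq'.2
    simp only [hK]
    rw [show (LamV1 (M + 1)).filter (fun q => q.1 + q.2 = K + 1) = {(0, K + 1), (1, K)} by
      ext ⟨i, j⟩
      simp only [Finset.mem_filter, mem_LamV1, Finset.mem_insert, Finset.mem_singleton,
        Prod.mk.injEq]
      omega, Finset.sum_pair (by simp), ← t]
    have hm := hq'.2
    interval_cases m
    · rw [if_pos rfl, show l = K + 1 by omega]
    · rw [if_neg one_ne_zero, show l = K by omega]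

/-! ### Existence of the coefficients by duality -/

/-- The transmission formula for the derivatives of order up to `M + 1`. -/
theorem exists_transmission_coeffs (J : Jet M) (hJ : J.Regular) {q' : ℕ × ℕ}
    (hq' : q' ∈ LamV1 (M + 1)) :
    ∃ cu cfp cfm cD cN : ℕ × ℕ → ℝ, ∀ x : ArraySpace, Transmits J x →
      x 1 q' = topSum J q' x
        + ∑ q ∈ (LamV1 (M + 1)).filter (fun q => 0 < q.1 + q.2 ∧ q.1 + q.2 < q'.1 + q'.2), cu q * x 0 q
        + ∑ q ∈ Lam (M - 1), cfp q * x 2 q + ∑ q ∈ Lam (M - 1), cfm q * x 3 q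
        + ∑ q ∈ Lam (M + 1), cD q * x 4 q + ∑ q ∈ Lam M, cN q * x 5 q := by
  classical
  let S : Finset (ℕ × ℕ) :=
    (LamV1 (M + 1)).filter (fun q => 0 < q.1 + q.2 ∧ q.1 + q.2 < q'.1 + q'.2)
  let ev (i : Fin 6) (q : ℕ × ℕ) : transmissionSpace J →ₗ[ℝ] ℝ :=
    entry i q ∘ₗ (transmissionSpace J).subtype
  have hev : ∀ i q (x : transmissionSpace J), ev i q x = x.1 i q := fun _ _ _ => rfl
  let L : (S ⊕ Lam (M - 1) ⊕ Lam (M - 1) ⊕ Lam (M + 1) ⊕ Lam M) → transmissionSpace J →ₗ[ℝ] ℝ :=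
    Sum.elim (fun q => ev 0 q) (Sum.elim (fun q => ev 2 q) (Sum.elim (fun q => ev 3 q)
      (Sum.elim (fun q => ev 4 q) (fun q => ev 5 q))))
  have key : ev 1 q' - topSum J q' ∘ₗ (transmissionSpace J).subtype
      ∈ Submodule.span ℝ (Set.range L) := by
    -- Duality: on the space of admissible arrays, the error of the leading formula vanishes
    -- wherever all the functionals in `L` vanish, since such an array has homogeneous data. Hence
    -- it is a combination of these functionals.
    refine mem_span_of_iInf_ker_le_ker fun x hx => ?_
    simp only [Submodule.mem_iInf, LinearMap.mem_ker] at hx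
    rw [LinearMap.mem_ker, LinearMap.sub_apply, sub_eq_zero]
    refine Transmits.uMinus_eq_topSum x.2 hJ hq' ⟨?_, ?_, ?_, ?_, ?_⟩
    · intro q h1 h2 h3
      have hq : q ∈ S := by
        rw [mem_LamV1] at hq'
        simp only [S, Finset.mem_filter, mem_LamV1]
        omega
      exact hx (Sum.inl ⟨q, hq⟩)
    · exact fun q hq => hx (Sum.inr (Sum.inl ⟨q, mem_Lam.2 hq⟩))
    · exact fun q hq => hx (Sum.inr (Sum.inr (Sum.inl ⟨q, mem_Lam.2 hq⟩)))
    · exact fun q hq => hx (Sum.inr (Sum.inr (Sum.inr (Sum.inl ⟨q, mem_Lam.2 hq⟩))))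
    · exact fun q hq => hx (Sum.inr (Sum.inr (Sum.inr (Sum.inr ⟨q, mem_Lam.2 hq⟩))))
  obtain ⟨c, hc⟩ := (Submodule.mem_span_range_iff_exists_fun ℝ).1 key
  -- Coefficients indexed by a finite set are extended by zero to all pairs.
  have ext {T : Finset (ℕ × ℕ)} (d : T → ℝ) : ∃ d' : ℕ × ℕ → ℝ, ∀ y : ℕ × ℕ → ℝ,
      ∑ q : T, d q * y q = ∑ q ∈ T, d' q * y q := by
    refine ⟨fun q => if h : q ∈ T then d ⟨q, h⟩ else 0, fun y => ?_⟩
    rw [← Finset.sum_coe_sort T]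
    refine Finset.sum_congr rfl fun q _ => ?_
    have hd : (if h : q.1 ∈ T then d ⟨q.1, h⟩ else 0) = d q := dif_pos q.2
    simp only [hd]
  obtain ⟨cu, hcu⟩ := ext fun q => c (Sum.inl q)
  obtain ⟨cfp, hcfp⟩ := ext fun q => c (Sum.inr (Sum.inl q))
  obtain ⟨cfm, hcfm⟩ := ext fun q => c (Sum.inr (Sum.inr (Sum.inl q)))
  obtain ⟨cD, hcD⟩ := ext fun q => c (Sum.inr (Sum.inr (Sum.inr (Sum.inl q))))
  obtain ⟨cN, hcN⟩ := ext fun q => c (Sum.inr (Sum.inr (Sum.inr (Sum.inr q))))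
  refine ⟨cu, cfp, cfm, cD, cN, fun x hx => ?_⟩
  have h := LinearMap.congr_fun hc ⟨x, hx⟩
  simp only [Fintype.sum_sum_type, LinearMap.add_apply, LinearMap.sum_apply, LinearMap.smul_apply,
    LinearMap.sub_apply, smul_eq_mul, L, Sum.elim_inl, Sum.elim_inr, hev, LinearMap.comp_apply,
    Submodule.subtype_apply, hcu, hcfp, hcfm, hcD, hcN] at h
  linarith

end

/-! ### Partial derivatives on open sets -/

section

variable {S : Set (ℝ × ℝ)} {F G : ℝ × ℝ → ℝ} {p : ℝ × ℝ}

theorem hasDerivAt_slice_fst (p : ℝ × ℝ) : HasDerivAt (fun x : ℝ => (x, p.2)) ((1 : ℝ), (0 : ℝ)) p.1 :=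
  (hasDerivAt_id p.1).prodMk (hasDerivAt_const p.1 p.2)

theorem hasDerivAt_slice_snd (p : ℝ × ℝ) : HasDerivAt (fun y : ℝ => (p.1, y)) ((0 : ℝ), (1 : ℝ)) p.2 :=
  (hasDerivAt_const p.2 p.1).prodMk (hasDerivAt_id p.2)

theorem partialX_eq_fderiv (h : DifferentiableAt ℝ F p) : partialX F p = fderiv ℝ F p (1, 0) :=
  (HasFDerivAt.comp_hasDerivAt p.1 (l := F) h.hasFDerivAt (hasDerivAt_slice_fst p)).deriv

theorem partialY_eq_fderiv (h : DifferentiableAt ℝ F p) : partialY F p = fderiv ℝ F p (0, 1) :=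
  (HasFDerivAt.comp_hasDerivAt p.2 (l := F) h.hasFDerivAt (hasDerivAt_slice_snd p)).deriv

/-- The chain rule in terms of partial derivatives. -/
theorem hasDerivAt_comp_curve {c : ℝ → ℝ × ℝ} {v : ℝ × ℝ} {t : ℝ}
    (h : DifferentiableAt ℝ F (c t)) (hc : HasDerivAt c v t) :
    HasDerivAt (fun t => F (c t)) (v.1 * partialX F (c t) + v.2 * partialY F (c t)) t := by
  have h1 := HasFDerivAt.comp_hasDerivAt t h.hasFDerivAt hc
  rw [partialX_eq_fderiv h, partialY_eq_fderiv h, ← smul_eq_mul, ← smul_eq_mul, ← map_smul,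
    ← map_smul, ← map_add]
  have hv : v.1 • ((1 : ℝ), (0 : ℝ)) + v.2 • ((0 : ℝ), (1 : ℝ)) = v := by ext <;> simp
  rw [hv]
  exact h1

theorem eqOn_partialX (hS : IsOpen S) (h : Set.EqOn F G S) :
    Set.EqOn (partialX F) (partialX G) S := by
  intro p hp
  refine Filter.EventuallyEq.deriv_eq ?_
  have : ∀ᶠ x in 𝓝 p.1, (x, p.2) ∈ S :=
    (hasDerivAt_slice_fst p).continuousAt.eventually (hS.mem_nhds hp)
  filter_upwards [this] with x hx using h hx

theorem eqOn_partialY (hS : IsOpen S) (h : Set.EqOn F G S) :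
    Set.EqOn (partialY F) (partialY G) S := by
  intro p hp
  refine Filter.EventuallyEq.deriv_eq ?_
  have : ∀ᶠ y in 𝓝 p.2, (p.1, y) ∈ S :=
    (hasDerivAt_slice_snd p).continuousAt.eventually (hS.mem_nhds hp)
  filter_upwards [this] with x hx using h hx

theorem eqOn_iterate_partialX (hS : IsOpen S) (h : Set.EqOn F G S) (m : ℕ) :
    Set.EqOn (partialX^[m] F) (partialX^[m] G) S := by
  induction m with
  | zero => exact h
  | succ m ih =>
    rw [Function.iterate_succ_apply', Function.iterate_succ_apply']
    exact eqOn_partialX hS ih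

theorem eqOn_iterate_partialY (hS : IsOpen S) (h : Set.EqOn F G S) (n : ℕ) :
    Set.EqOn (partialY^[n] F) (partialY^[n] G) S := by
  induction n with
  | zero => exact h
  | succ n ih =>
    rw [Function.iterate_succ_apply', Function.iterate_succ_apply']
    exact eqOn_partialY hS ih

theorem eqOn_pderiv (hS : IsOpen S) (h : Set.EqOn F G S) (q : ℕ × ℕ) :
    Set.EqOn (pderiv q F) (pderiv q G) S :=
  eqOn_iterate_partialX hS (eqOn_iterate_partialY hS h q.2) q.1

theorem contDiffOn_fderiv_apply {k : ℕ} (hS : IsOpen S) (h : ContDiffOn ℝ (k + 1 : ℕ) F S)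
    (v : ℝ × ℝ) : ContDiffOn ℝ k (fun p => fderiv ℝ F p v) S :=
  (h.fderiv_of_isOpen hS (m := k) (by exact_mod_cast le_rfl)).clm_apply contDiffOn_const

theorem differentiableAt_of_contDiffOn {k : ℕ} (hS : IsOpen S) (h : ContDiffOn ℝ (k + 1 : ℕ) F S)
    (hp : p ∈ S) : DifferentiableAt ℝ F p :=
  (h.contDiffAt (hS.mem_nhds hp)).differentiableAt (by simp)

theorem eqOn_partialX_fderiv {k : ℕ} (hS : IsOpen S) (h : ContDiffOn ℝ (k + 1 : ℕ) F S) :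
    Set.EqOn (partialX F) (fun p => fderiv ℝ F p (1, 0)) S :=
  fun _ hp => partialX_eq_fderiv (differentiableAt_of_contDiffOn hS h hp)

theorem eqOn_partialY_fderiv {k : ℕ} (hS : IsOpen S) (h : ContDiffOn ℝ (k + 1 : ℕ) F S) :
    Set.EqOn (partialY F) (fun p => fderiv ℝ F p (0, 1)) S :=
  fun _ hp => partialY_eq_fderiv (differentiableAt_of_contDiffOn hS h hp)

theorem contDiffOn_partialX {k : ℕ} (hS : IsOpen S) (h : ContDiffOn ℝ (k + 1 : ℕ) F S) :
    ContDiffOn ℝ k (partialX F) S :=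
  (contDiffOn_fderiv_apply hS h (1, 0)).congr (eqOn_partialX_fderiv hS h)

theorem contDiffOn_partialY {k : ℕ} (hS : IsOpen S) (h : ContDiffOn ℝ (k + 1 : ℕ) F S) :
    ContDiffOn ℝ k (partialY F) S :=
  (contDiffOn_fderiv_apply hS h (0, 1)).congr (eqOn_partialY_fderiv hS h)

theorem contDiffOn_iterate_partialX (hS : IsOpen S) (m : ℕ) {k : ℕ}
    (h : ContDiffOn ℝ (k + m : ℕ) F S) : ContDiffOn ℝ k (partialX^[m] F) S := by
  induction m generalizing k with
  | zero => exact h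
  | succ m ih =>
    rw [Function.iterate_succ_apply']
    exact contDiffOn_partialX hS (ih (by rwa [add_right_comm] : ContDiffOn ℝ (k + 1 + m : ℕ) F S))

theorem contDiffOn_iterate_partialY (hS : IsOpen S) (n : ℕ) {k : ℕ}
    (h : ContDiffOn ℝ (k + n : ℕ) F S) : ContDiffOn ℝ k (partialY^[n] F) S := by
  induction n generalizing k with
  | zero => exact h
  | succ n ih =>
    rw [Function.iterate_succ_apply']
    exact contDiffOn_partialY hS (ih (by rwa [add_right_comm] : ContDiffOn ℝ (k + 1 + n : ℕ) F S))

theorem contDiffOn_pderiv (hS : IsOpen S) {K : ℕ} (h : ContDiffOn ℝ K F S) (q : ℕ × ℕ) {k : ℕ}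
    (hk : k + (q.1 + q.2) ≤ K) : ContDiffOn ℝ k (pderiv q F) S := by
  refine contDiffOn_iterate_partialX hS _ (contDiffOn_iterate_partialY hS _ (h.of_le ?_))
  exact_mod_cast (by omega : k + q.1 + q.2 ≤ K)

/-- Mixed second derivatives commute. -/
theorem partialX_partialY_comm (hS : IsOpen S) (h : ContDiffOn ℝ (2 : ℕ) F S) :
    Set.EqOn (partialX (partialY F)) (partialY (partialX F)) S := by
  intro p hp
  have hd : DifferentiableAt ℝ (fderiv ℝ F) p :=
    ((h.fderiv_of_isOpen hS (m := 1) (by norm_num)).contDiffAt (hS.mem_nhds hp)).differentiableAt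
      one_ne_zero
  have hdir : ∀ v w : ℝ × ℝ, fderiv ℝ (fun z => fderiv ℝ F z v) p w = fderiv ℝ (fderiv ℝ F) p w v := by
    intro v w
    rw [fderiv_clm_apply hd (differentiableAt_const v)]
    simp
  rw [eqOn_partialX hS (eqOn_partialY_fderiv (k := 1) hS h) hp,
    eqOn_partialY hS (eqOn_partialX_fderiv (k := 1) hS h) hp,
    eqOn_partialX_fderiv (k := 0) hS (contDiffOn_fderiv_apply (k := 1) hS h _) hp,
    eqOn_partialY_fderiv (k := 0) hS (contDiffOn_fderiv_apply (k := 1) hS h _) hp]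
  simp only [hdir]
  exact (h.contDiffAt (hS.mem_nhds hp)).isSymmSndFDerivAt (by simp) _ _

theorem partialY_iterate_partialX (hS : IsOpen S) (m : ℕ) :
    ∀ {F : ℝ × ℝ → ℝ}, ContDiffOn ℝ (m + 1 : ℕ) F S →
      Set.EqOn (partialY (partialX^[m] F)) (partialX^[m] (partialY F)) S := by
  induction m with
  | zero => exact fun _ _ _ => rfl
  | succ m ih =>
    intro F h p hp
    rw [Function.iterate_succ_apply, Function.iterate_succ_apply, ih (contDiffOn_partialX hS h) hp]
    refine eqOn_iterate_partialX hS ?_ m hp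
    exact (partialX_partialY_comm hS (h.of_le (by exact_mod_cast (by omega : 2 ≤ m + 1 + 1)))).symm

theorem partialX_iterate_partialY (hS : IsOpen S) (n : ℕ) :
    ∀ {F : ℝ × ℝ → ℝ}, ContDiffOn ℝ (n + 1 : ℕ) F S →
      Set.EqOn (partialX (partialY^[n] F)) (partialY^[n] (partialX F)) S := by
  induction n with
  | zero => exact fun _ _ _ => rfl
  | succ n ih =>
    intro F h p hp
    rw [Function.iterate_succ_apply, Function.iterate_succ_apply, ih (contDiffOn_partialY hS h) hp]
    refine eqOn_iterate_partialY hS ?_ n hp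
    exact partialX_partialY_comm hS (h.of_le (by exact_mod_cast (by omega : 2 ≤ n + 1 + 1)))

theorem partialX_pderiv (q : ℕ × ℕ) (F : ℝ × ℝ → ℝ) :
    partialX (pderiv q F) = pderiv (q.1 + 1, q.2) F :=
  (Function.iterate_succ_apply' partialX q.1 _).symm

theorem pderiv_partialY (q : ℕ × ℕ) (F : ℝ × ℝ → ℝ) :
    pderiv q (partialY F) = pderiv (q.1, q.2 + 1) F := rfl

/-- In `pderiv` the x-derivatives are taken last, so a further y-derivative has to be commuted past
them; this uses the smoothness of order |q| + 1. -/
theorem partialY_pderiv (hS : IsOpen S) (q : ℕ × ℕ) (h : ContDiffOn ℝ (q.1 + q.2 + 1 : ℕ) F S) :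
    Set.EqOn (partialY (pderiv q F)) (pderiv (q.1, q.2 + 1) F) S := by
  have h1 := partialY_iterate_partialX hS q.1 (F := partialY^[q.2] F)
    (contDiffOn_iterate_partialY hS _ (by rwa [add_right_comm]))
  rwa [← Function.iterate_succ_apply' partialY] at h1

theorem pderiv_partialX (hS : IsOpen S) (q : ℕ × ℕ) (h : ContDiffOn ℝ (q.1 + q.2 + 1 : ℕ) F S) :
    Set.EqOn (pderiv q (partialX F)) (pderiv (q.1 + 1, q.2) F) S := by
  have h1 := partialX_iterate_partialY hS q.2 (F := F)
    (h.of_le (by exact_mod_cast (by omega : q.2 + 1 ≤ q.1 + q.2 + 1)))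
  exact (eqOn_iterate_partialX hS h1 q.1).symm

theorem iterate_partialX_eq_iteratedDeriv (m : ℕ) :
    ∀ p : ℝ × ℝ, partialX^[m] F p = iteratedDeriv m (fun x => F (x, p.2)) p.1 := by
  induction m with
  | zero => intro p; rw [iteratedDeriv_zero]; rfl
  | succ m ih =>
    intro p
    rw [Function.iterate_succ_apply', iteratedDeriv_succ]
    exact congrArg (fun g => deriv g p.1) (funext fun x => ih (x, p.2))

theorem iterate_partialY_eq_iteratedDeriv (n : ℕ) :
    ∀ p : ℝ × ℝ, partialY^[n] F p = iteratedDeriv n (fun y => F (p.1, y)) p.2 := by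
  induction n with
  | zero => intro p; rw [iteratedDeriv_zero]; rfl
  | succ n ih =>
    intro p
    rw [Function.iterate_succ_apply', iteratedDeriv_succ]
    exact congrArg (fun g => deriv g p.2) (funext fun y => ih (p.1, y))

theorem contDiffAt_slice_fst {n : ℕ} (h : ContDiffAt ℝ n F p) :
    ContDiffAt ℝ n (fun x => F (x, p.2)) p.1 :=
  ContDiffAt.comp p.1 (g := F) h (contDiffAt_id.prodMk contDiffAt_const)

theorem contDiffAt_slice_snd {n : ℕ} (h : ContDiffAt ℝ n F p) :
    ContDiffAt ℝ n (fun y => F (p.1, y)) p.2 :=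
  ContDiffAt.comp p.2 (g := F) h (contDiffAt_const.prodMk contDiffAt_id)

/-- The Leibniz rule for partial derivatives. -/
theorem pderiv_mul (hS : IsOpen S) (q : ℕ × ℕ) (hF : ContDiffOn ℝ (q.1 + q.2 : ℕ) F S)
    (hG : ContDiffOn ℝ (q.1 + q.2 : ℕ) G S) (hp : p ∈ S) :
    pderiv q (fun z => F z * G z) p
      = leibniz₂ (fun q => pderiv q F p) (fun q => pderiv q G p) q := by
  have hY : Set.EqOn (partialY^[q.2] fun z => F z * G z)
      (fun z => ∑ j ∈ Finset.range (q.2 + 1), (q.2.choose j : ℝ) *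
        (partialY^[j] F z * partialY^[q.2 - j] G z)) S := by
    intro z hz
    have h1 : ContDiffAt ℝ q.2 F z :=
      (hF.contDiffAt (hS.mem_nhds hz)).of_le (by exact_mod_cast Nat.le_add_left _ _)
    have h2 : ContDiffAt ℝ q.2 G z :=
      (hG.contDiffAt (hS.mem_nhds hz)).of_le (by exact_mod_cast Nat.le_add_left _ _)
    rw [iterate_partialY_eq_iteratedDeriv,
      iteratedDeriv_fun_mul (contDiffAt_slice_snd h1) (contDiffAt_slice_snd h2)]
    refine Finset.sum_congr rfl fun j _ => ?_
    rw [iterate_partialY_eq_iteratedDeriv, iterate_partialY_eq_iteratedDeriv, mul_assoc]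
  have h1 : ∀ j ≤ q.2, ContDiffAt ℝ q.1 (partialY^[j] F) p := fun j hj =>
    (contDiffOn_iterate_partialY hS j (hF.of_le (by exact_mod_cast
      (by omega : q.1 + j ≤ q.1 + q.2)))).contDiffAt (hS.mem_nhds hp)
  have h2 : ∀ j ≤ q.2, ContDiffAt ℝ q.1 (partialY^[j] G) p := fun j hj =>
    (contDiffOn_iterate_partialY hS j (hG.of_le (by exact_mod_cast
      (by omega : q.1 + j ≤ q.1 + q.2)))).contDiffAt (hS.mem_nhds hp)
  rw [pderiv, eqOn_iterate_partialX hS hY q.1 hp, iterate_partialX_eq_iteratedDeriv,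
    iteratedDeriv_fun_sum, leibniz₂_apply, Finset.sum_comm]
  · refine Finset.sum_congr rfl fun j hj => ?_
    have hj' : j ≤ q.2 := Nat.lt_succ_iff.1 (Finset.mem_range.1 hj)
    rw [iteratedDeriv_const_mul_field, iteratedDeriv_fun_mul (contDiffAt_slice_fst (h1 j hj'))
      (contDiffAt_slice_fst (h2 (q.2 - j) (Nat.sub_le _ _))), Finset.mul_sum]
    refine Finset.sum_congr rfl fun i _ => ?_
    simp only [pderiv, iterate_partialX_eq_iteratedDeriv]
    ring
  · intro j hj
    have hj' : j ≤ q.2 := Nat.lt_succ_iff.1 (Finset.mem_range.1 hj)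
    exact contDiffAt_const.mul ((contDiffAt_slice_fst (h1 j hj')).mul
      (contDiffAt_slice_fst (h2 (q.2 - j) (Nat.sub_le _ _))))

theorem pderiv_neg (q : ℕ × ℕ) (F : ℝ × ℝ → ℝ) (p : ℝ × ℝ) :
    pderiv q (fun z => -F z) p = -pderiv q F p := by
  have h : partialY^[q.2] (fun z => -F z) = fun z => -partialY^[q.2] F z := by
    funext z
    rw [iterate_partialY_eq_iteratedDeriv, iterate_partialY_eq_iteratedDeriv, iteratedDeriv_fun_neg]
  rw [pderiv, h, iterate_partialX_eq_iteratedDeriv, iteratedDeriv_fun_neg, pderiv,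
    iterate_partialX_eq_iteratedDeriv]

theorem pderiv_add (hS : IsOpen S) (q : ℕ × ℕ) (hF : ContDiffOn ℝ (q.1 + q.2 : ℕ) F S)
    (hG : ContDiffOn ℝ (q.1 + q.2 : ℕ) G S) (hp : p ∈ S) :
    pderiv q (fun z => F z + G z) p = pderiv q F p + pderiv q G p := by
  have hY : Set.EqOn (partialY^[q.2] fun z => F z + G z)
      (fun z => partialY^[q.2] F z + partialY^[q.2] G z) S := by
    intro z hz
    have h1 : ContDiffAt ℝ q.2 F z :=
      (hF.contDiffAt (hS.mem_nhds hz)).of_le (by exact_mod_cast Nat.le_add_left _ _)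
    have h2 : ContDiffAt ℝ q.2 G z :=
      (hG.contDiffAt (hS.mem_nhds hz)).of_le (by exact_mod_cast Nat.le_add_left _ _)
    simp only [iterate_partialY_eq_iteratedDeriv]
    exact iteratedDeriv_add (contDiffAt_slice_snd h1) (contDiffAt_slice_snd h2)
  have h1 : ContDiffAt ℝ q.1 (partialY^[q.2] F) p :=
    (contDiffOn_iterate_partialY hS q.2 hF).contDiffAt (hS.mem_nhds hp)
  have h2 : ContDiffAt ℝ q.1 (partialY^[q.2] G) p :=
    (contDiffOn_iterate_partialY hS q.2 hG).contDiffAt (hS.mem_nhds hp)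
  simp only [pderiv]
  rw [eqOn_iterate_partialX hS hY q.1 hp]
  simp only [iterate_partialX_eq_iteratedDeriv]
  exact iteratedDeriv_add (contDiffAt_slice_fst h1) (contDiffAt_slice_fst h2)

/-- The derivatives of a divergence. -/
theorem pderiv_divergence (hS : IsOpen S) (q : ℕ × ℕ) {a u : ℝ × ℝ → ℝ}
    (ha : ContDiffOn ℝ (q.1 + q.2 + 1 : ℕ) a S) (hu : ContDiffOn ℝ (q.1 + q.2 + 2 : ℕ) u S)
    {f : ℝ × ℝ → ℝ} (hf : ∀ z ∈ S, -(partialX (fun z => a z * partialX u z) z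
      + partialY (fun z => a z * partialY u z) z) = f z) (hp : p ∈ S) :
    ellipticJet (fun q => pderiv q a p) (fun q => pderiv q u p) q = -pderiv q f p := by
  have hux : ContDiffOn ℝ (q.1 + q.2 + 1 : ℕ) (partialX u) S := contDiffOn_partialX hS hu
  have huy : ContDiffOn ℝ (q.1 + q.2 + 1 : ℕ) (partialY u) S := contDiffOn_partialY hS hu
  have hvx := ha.mul hux
  have hvy := ha.mul huy
  have h : Set.EqOn (fun z => partialX (fun z => a z * partialX u z) z
      + partialY (fun z => a z * partialY u z) z) (fun z => -f z) S := fun z hz => by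
    beta_reduce
    rw [← hf z hz, neg_neg]
  have key := eqOn_pderiv hS h q hp
  rw [pderiv_neg, pderiv_add hS q (contDiffOn_partialX hS hvx) (contDiffOn_partialY hS hvy) hp,
    pderiv_partialX hS q hvx hp, pderiv_partialY,
    pderiv_mul hS (q.1 + 1, q.2) (by convert ha using 2; ring) (by convert hux using 2; ring) hp,
    pderiv_mul hS (q.1, q.2 + 1) ha huy hp] at key
  rw [← key, ellipticJet_apply, leibniz₂_apply, leibniz₂_apply, leibniz₂_apply, leibniz₂_apply]
  congr 1
  refine Finset.sum_congr rfl fun i _ => Finset.sum_congr rfl fun j _ => ?_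
  rw [shiftX_apply, pderiv_partialX hS _ (hu.of_le _) hp]
  simp only
  exact_mod_cast (by omega)

end

/-! ### Derivatives along a curve -/

/-- A family of functions of one variable that behaves like the family of all partial derivatives of
order up to `K` of a function along the curve `(r, s)`. -/
structure IsCurveFamily (I : Set ℝ) (r s : ℝ → ℝ) (K : ℕ) (y : ℕ × ℕ → ℝ → ℝ) : Prop where
  continuousOn : ∀ q : ℕ × ℕ, q.1 + q.2 ≤ K → ContinuousOn (y q) I
  hasDerivAt : ∀ q : ℕ × ℕ, q.1 + q.2 < K → ∀ t ∈ I,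
    HasDerivAt (y q) (deriv r t * y (q.1 + 1, q.2) t + deriv s t * y (q.1, q.2 + 1) t) t

section

variable {I : Set ℝ} {r s : ℝ → ℝ} {K : ℕ} {y : ℕ × ℕ → ℝ → ℝ}

theorem contDiffOn_deriv {g : ℝ → ℝ} {k : ℕ} (hI : IsOpen I) (h : ContDiffOn ℝ (k + 1 : ℕ) g I) :
    ContDiffOn ℝ k (deriv g) I :=
  h.deriv_of_isOpen hI (by exact_mod_cast le_rfl)

/-- Bootstrapping: the derivative of a member of order |q| is a combination, with coefficients r'
and s', of members of order |q| + 1, so each order below K gains one degree of smoothness. -/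
theorem IsCurveFamily.contDiffOn (hy : IsCurveFamily I r s K y) (hI : IsOpen I)
    (hr : ContDiffOn ℝ K r I) (hs : ContDiffOn ℝ K s I) (k : ℕ) :
    ∀ q : ℕ × ℕ, q.1 + q.2 + k ≤ K → ContDiffOn ℝ k (y q) I := by
  induction k with
  | zero => exact fun q hq => contDiffOn_zero.2 (hy.continuousOn q hq)
  | succ k ih =>
    intro q hq
    have hr' := contDiffOn_deriv hI (k := k) (hr.of_le (by exact_mod_cast (by omega : k + 1 ≤ K)))
    have hs' := contDiffOn_deriv hI (k := k) (hs.of_le (by exact_mod_cast (by omega : k + 1 ≤ K)))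
    rw [show ((k + 1 : ℕ) : WithTop ℕ∞) = (k : WithTop ℕ∞) + 1 by norm_cast,
      contDiffOn_succ_iff_deriv_of_isOpen hI]
    refine ⟨fun t ht => (hy.hasDerivAt q (by omega) t ht).differentiableAt.differentiableWithinAt,
      by simp, ?_⟩
    refine ((hr'.mul (ih (q.1 + 1, q.2) (by simp only; omega))).add
      (hs'.mul (ih (q.1, q.2 + 1) (by simp only; omega)))).congr fun t ht => ?_
    exact (hy.hasDerivAt q (by omega) t ht).deriv

/-- The derivatives of a family of partial derivatives along a curve. -/
theorem IsCurveFamily.iteratedDeriv_eq (hy : IsCurveFamily I r s K y) (hI : IsOpen I) {t : ℝ}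
    (ht : t ∈ I) (hr : ContDiffOn ℝ K r I) (hs : ContDiffOn ℝ K s I) {r₀ s₀ : ℕ → ℝ}
    (hr₀ : ∀ k ≤ K, r₀ k = iteratedDeriv k r t) (hs₀ : ∀ k ≤ K, s₀ k = iteratedDeriv k s t)
    {G : ℕ × ℕ → ℝ} (hG : ∀ q : ℕ × ℕ, q.1 + q.2 ≤ K → G q = y q t) (k : ℕ) :
    ∀ q : ℕ × ℕ, q.1 + q.2 + k ≤ K → iteratedDeriv k (y q) t = curveDeriv r₀ s₀ k G q := by
  induction k using Nat.strong_induction_on with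
  | _ k ih =>
    intro q hq
    cases k with
    | zero => rw [iteratedDeriv_zero, curveDeriv_zero, hG q hq]
    | succ k =>
      have hr' : ContDiffAt ℝ k (deriv r) t := (contDiffOn_deriv hI (hr.of_le
        (by exact_mod_cast (by omega : k + 1 ≤ K)))).contDiffAt (hI.mem_nhds ht)
      have hs' : ContDiffAt ℝ k (deriv s) t := (contDiffOn_deriv hI (hs.of_le
        (by exact_mod_cast (by omega : k + 1 ≤ K)))).contDiffAt (hI.mem_nhds ht)
      have h1 : ContDiffAt ℝ k (y (q.1 + 1, q.2)) t :=
        (hy.contDiffOn hI hr hs k _ (by simp only; omega)).contDiffAt (hI.mem_nhds ht)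
      have h2 : ContDiffAt ℝ k (y (q.1, q.2 + 1)) t :=
        (hy.contDiffOn hI hr hs k _ (by simp only; omega)).contDiffAt (hI.mem_nhds ht)
      have he : deriv (y q) =ᶠ[𝓝 t] fun t =>
          deriv r t * y (q.1 + 1, q.2) t + deriv s t * y (q.1, q.2 + 1) t := by
        filter_upwards [hI.mem_nhds ht] with t ht
        exact (hy.hasDerivAt q (by omega) t ht).deriv
      rw [iteratedDeriv_succ', he.iteratedDeriv_eq, curveDeriv_succ]
      refine (iteratedDeriv_add (hr'.mul h1) (hs'.mul h2)).trans ?_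
      rw [iteratedDeriv_fun_mul hr' h1, iteratedDeriv_fun_mul hs' h2, ← Finset.sum_add_distrib]
      refine Finset.sum_congr rfl fun i hi => ?_
      rw [Finset.mem_range] at hi
      rw [hr₀ (i + 1) (by omega), hs₀ (i + 1) (by omega), iteratedDeriv_succ', iteratedDeriv_succ',
        ih (k - i) (by omega) _ (by simp only; omega), ih (k - i) (by omega) _ (by simp only; omega)]
      ring

end

/-! ### One-sided limits -/

section

variable {S : Set (ℝ × ℝ)} {F : ℝ × ℝ → ℝ} {p : ℝ × ℝ}

/-- A uniformly continuous function maps the Cauchy filter of neighbourhoods within S to a Cauchy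
filter, which converges by completeness. So `limUnder` is a genuine limit here. -/
theorem tendsto_limFrom (hF : UniformContinuousOn F S) (hp : p ∈ closure S) :
    Tendsto F (𝓝[S] p) (𝓝 (limFrom S F p)) := by
  have : (𝓝[S] p).NeBot := mem_closure_iff_nhdsWithin_neBot.1 hp
  refine tendsto_nhds_limUnder (cauchy_iff_exists_le_nhds.1 ⟨inferInstance, ?_⟩)
  have h1 : 𝓝[S] p ×ˢ 𝓝[S] p ≤ uniformity (ℝ × ℝ) ⊓ 𝓟 (S ×ˢ S) := by
    refine le_inf ?_ ?_
    · exact (Filter.prod_mono nhdsWithin_le_nhds nhdsWithin_le_nhds).trans (cauchy_nhds (a := p)).2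
    · rw [← Filter.prod_principal_principal]
      exact Filter.prod_mono inf_le_right inf_le_right
  rw [Filter.prod_map_map_eq]
  exact (Filter.map_mono h1).trans hF

theorem limFrom_eq (hp : p ∈ closure S) {L : ℝ} (h : Tendsto F (𝓝[S] p) (𝓝 L)) :
    limFrom S F p = L :=
  haveI : (𝓝[S] p).NeBot := mem_closure_iff_nhdsWithin_neBot.1 hp
  h.limUnder_eq

theorem dist_limFrom_le {ε δ : ℝ} (hF : UniformContinuousOn F S)
    (h : ∀ x ∈ S, ∀ y ∈ S, dist x y < δ → dist (F x) (F y) < ε) (hp : p ∈ closure S)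
    {x : ℝ × ℝ} (hx : x ∈ S) (hxp : dist x p < δ) : dist (F x) (limFrom S F p) ≤ ε := by
  have : (𝓝[S] p).NeBot := mem_closure_iff_nhdsWithin_neBot.1 hp
  refine le_of_tendsto (tendsto_const_nhds.dist (tendsto_limFrom hF hp)) ?_
  have hnear : ∀ᶠ y in 𝓝[S] p, dist x y < δ :=
    nhdsWithin_le_nhds ((continuous_const.dist continuous_id).continuousAt.eventually_lt
      continuousAt_const hxp)
  filter_upwards [hnear, self_mem_nhdsWithin] with y hy hyS
  exact (h x hx y hyS hy).le

/-- The curve `c` can be pushed into `S` in the direction `n`. -/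
def Pushes (S : Set (ℝ × ℝ)) (I : Set ℝ) (c : ℝ → ℝ × ℝ) (n : ℝ × ℝ) : Prop :=
  ∃ δ > 0, ∀ t ∈ I, ∀ h ∈ Set.Ioo (0 : ℝ) δ, c t + h • n ∈ S

variable {I : Set ℝ} {c : ℝ → ℝ × ℝ} {n : ℝ × ℝ}

theorem Pushes.mem_closure (h : Pushes S I c n) {t : ℝ} (ht : t ∈ I) : c t ∈ closure S := by
  obtain ⟨δ, hδ, h⟩ := h
  have hc : Continuous fun h : ℝ => c t + h • n := by fun_prop
  have ht0 : Tendsto (fun h : ℝ => c t + h • n) (𝓝[>] 0) (𝓝 (c t)) := by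
    have := (hc.tendsto 0).mono_left (nhdsWithin_le_nhds (s := Set.Ioi 0))
    simpa using this
  refine mem_closure_of_tendsto ht0 ?_
  filter_upwards [Ioo_mem_nhdsGT hδ] with x hx using h t ht x hx

/-- The displaced point is at distance ‖h • n‖ from the curve for every t, so one modulus of
continuity serves the whole interval. -/
theorem Pushes.tendstoUniformlyOn (h : Pushes S I c n) (hF : UniformContinuousOn F S) :
    TendstoUniformlyOn (fun (h : ℝ) t => F (c t + h • n)) (fun t => limFrom S F (c t)) (𝓝[>] 0) I := by
  have hcl := fun t (ht : t ∈ I) => h.mem_closure ht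
  obtain ⟨δ, hδ, h⟩ := h
  rw [Metric.tendstoUniformlyOn_iff]
  intro ε hε
  obtain ⟨η, hη, hF'⟩ := Metric.uniformContinuousOn_iff.1 hF (ε / 2) (half_pos hε)
  have hsmall : ∀ᶠ h : ℝ in 𝓝[>] 0, ‖h • n‖ < η := by
    have hc : Continuous fun h : ℝ => ‖h • n‖ := by fun_prop
    exact nhdsWithin_le_nhds (hc.continuousAt.eventually_lt continuousAt_const (by simpa using hη))
  filter_upwards [hsmall, Ioo_mem_nhdsGT hδ] with k hk1 hk2 t ht
  rw [dist_comm]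
  refine (dist_limFrom_le hF hF' (hcl t ht) (h t ht k hk2) ?_).trans_lt (half_lt_self hε)
  simpa [dist_eq_norm] using hk1

theorem tendstoUniformlyOn_bounded_mul {ι : Type*} {l : Filter ι} {f : ι → ℝ → ℝ} {g b : ℝ → ℝ}
    (h : TendstoUniformlyOn f g l I) {C : ℝ} (hb : ∀ t ∈ I, |b t| ≤ C) :
    TendstoUniformlyOn (fun i t => b t * f i t) (fun t => b t * g t) l I := by
  rw [Metric.tendstoUniformlyOn_iff] at h ⊢
  intro ε hε
  have hC : 0 < |C| + 1 := by positivity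
  filter_upwards [h (ε / (|C| + 1)) (div_pos hε hC)] with i hi t ht
  have h1 := hi t ht
  rw [lt_div_iff₀ hC] at h1
  rw [Real.dist_eq, ← mul_sub, abs_mul, ← Real.dist_eq]
  have h2 : |b t| ≤ |C| + 1 := (hb t ht).trans ((le_abs_self C).trans (by linarith))
  nlinarith [dist_nonneg (x := g t) (y := f i t)]

theorem Pushes.continuousOn (h : Pushes S I c n) (hF : UniformContinuousOn F S)
    (hc : ContinuousOn c I) : ContinuousOn (fun t => limFrom S F (c t)) I := by
  refine (h.tendstoUniformlyOn hF).continuousOn ?_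
  obtain ⟨δ, hδ, h⟩ := h
  refine Filter.Eventually.frequently ?_
  filter_upwards [Ioo_mem_nhdsGT hδ] with k hk
  exact hF.continuousOn.comp (hc.add continuousOn_const) fun t ht => h t ht k hk

/-- The one-sided limits of a function along a curve satisfy the chain rule. -/
theorem Pushes.hasDerivAt (h : Pushes S I c n) (hS : IsOpen S) (hI : IsOpen I)
    (hd : ContDiffOn ℝ (1 : ℕ) F S) (hF : UniformContinuousOn F S)
    (hX : UniformContinuousOn (partialX F) S) (hY : UniformContinuousOn (partialY F) S)
    {v : ℝ → ℝ × ℝ} (hc : ∀ t ∈ I, HasDerivAt c (v t) t) {C : ℝ} (hv₁ : ∀ t ∈ I, |(v t).1| ≤ C)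
    (hv₂ : ∀ t ∈ I, |(v t).2| ≤ C) {t : ℝ} (ht : t ∈ I) :
    HasDerivAt (fun t => limFrom S F (c t))
      ((v t).1 * limFrom S (partialX F) (c t) + (v t).2 * limFrom S (partialY F) (c t)) t := by
  -- Along each displaced curve the ordinary chain rule holds inside S. The derivatives converge
  -- uniformly, because the velocity is bounded, and the functions converge pointwise, so
  -- differentiation commutes with the limit.
  refine hasDerivAt_of_tendstoUniformlyOn (l := 𝓝[>] (0 : ℝ)) (f := fun h t => F (c t + h • n))
    (f' := fun h t => (v t).1 * partialX F (c t + h • n) + (v t).2 * partialY F (c t + h • n))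
    (g' := fun t => (v t).1 * limFrom S (partialX F) (c t) + (v t).2 * limFrom S (partialY F) (c t))
    hI ?_ ?_ ?_ ht
  · exact (tendstoUniformlyOn_bounded_mul (h.tendstoUniformlyOn hX) hv₁).add
      (tendstoUniformlyOn_bounded_mul (h.tendstoUniformlyOn hY) hv₂)
  · obtain ⟨δ, hδ, h⟩ := h
    filter_upwards [Ioo_mem_nhdsGT hδ] with k hk t ht
    exact hasDerivAt_comp_curve (c := fun t => c t + k • n)
      (differentiableAt_of_contDiffOn (k := 0) hS hd (h t ht k hk)) ((hc t ht).add_const _)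
  · exact fun t ht => (h.tendstoUniformlyOn hF).tendsto_at ht

/-- The one-sided limits of the partial derivatives form a family of partial derivatives along the
boundary curve. -/
theorem Pushes.isCurveFamily (h : Pushes S I c n) (hS : IsOpen S) (hI : IsOpen I) {K : ℕ}
    (hF : UniformlySmoothOn K F S) {r s : ℝ → ℝ}
    (hc : ∀ t ∈ I, HasDerivAt c (deriv r t, deriv s t) t) {C : ℝ} (hr : ∀ t ∈ I, |deriv r t| ≤ C)
    (hs : ∀ t ∈ I, |deriv s t| ≤ C) :
    IsCurveFamily I r s K fun q t => limFrom S (pderiv q F) (c t) := by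
  refine ⟨fun q hq => h.continuousOn (hF.2 q (mem_Lam.2 hq))
    fun t ht => (hc t ht).continuousAt.continuousWithinAt, fun q hq t ht => ?_⟩
  have hcY : Set.EqOn (partialY (pderiv q F)) (pderiv (q.1, q.2 + 1) F) S :=
    partialY_pderiv hS q (hF.1.of_le (by exact_mod_cast hq))
  have hX : UniformContinuousOn (partialX (pderiv q F)) S := by
    rw [partialX_pderiv]
    exact hF.2 _ (mem_Lam.2 (by simp only; omega))
  have hY' := hF.2 (q.1, q.2 + 1) (mem_Lam.2 (by simp only; omega))
  have hY : UniformContinuousOn (partialY (pderiv q F)) S := hY'.congr hcY.symm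
  have key := h.hasDerivAt hS hI (contDiffOn_pderiv hS hF.1 q (by omega))
    (hF.2 q (mem_Lam.2 hq.le)) hX hY hc hr hs ht
  have hlim : limFrom S (partialY (pderiv q F)) (c t) = limFrom S (pderiv (q.1, q.2 + 1) F) (c t) :=
    limFrom_eq (h.mem_closure ht) ((tendsto_limFrom hY' (h.mem_closure ht)).congr'
      (eventually_nhdsWithin_of_forall fun z hz => (hcY hz).symm))
  rwa [hlim, partialX_pderiv] at key

/-- The partial derivatives of a smooth function form a family of partial derivatives along a
curve. -/
theorem isCurveFamily_comp (hS : IsOpen S) {K : ℕ} (hF : ContDiffOn ℝ K F S) {r s : ℝ → ℝ}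
    (hc : ∀ t ∈ I, HasDerivAt c (deriv r t, deriv s t) t) (hcS : ∀ t ∈ I, c t ∈ S) :
    IsCurveFamily I r s K fun q t => pderiv q F (c t) := by
  refine ⟨fun q hq => ?_, fun q hq t ht => ?_⟩
  · exact (contDiffOn_pderiv hS hF q (k := 0) (by omega)).continuousOn.comp
      (fun t ht => (hc t ht).continuousAt.continuousWithinAt) hcS
  · have key := hasDerivAt_comp_curve (F := pderiv q F) (differentiableAt_of_contDiffOn (k := 0) hS
      (contDiffOn_pderiv hS hF q (by omega)) (hcS t ht)) (hc t ht)
    rwa [partialX_pderiv, partialY_pderiv hS q (hF.of_le (by exact_mod_cast hq)) (hcS t ht)] at key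

/-- The one-sided limits of the derivatives satisfy the elliptic equation. -/
theorem ellipticJet_limFrom (hS : IsOpen S) {M : ℕ} {a u f : ℝ × ℝ → ℝ}
    (ha : UniformlySmoothOn M a S) (hu : UniformlySmoothOn (M + 1) u S)
    (hf : UniformlySmoothOn (M - 1) f S)
    (hpde : ∀ z ∈ S, -(partialX (fun z => a z * partialX u z) z
      + partialY (fun z => a z * partialY u z) z) = f z) (hp : p ∈ closure S) {A : ℕ × ℕ → ℝ}
    (hA : ∀ q ∈ Lam M, A q = limFrom S (pderiv q a) p) (q : ℕ × ℕ) (hq : q.1 + q.2 + 1 ≤ M) :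
    ellipticJet A (fun q => limFrom S (pderiv q u) p) q = -limFrom S (pderiv q f) p := by
  have : (𝓝[S] p).NeBot := mem_closure_iff_nhdsWithin_neBot.1 hp
  have la : ∀ q : ℕ × ℕ, q.1 + q.2 ≤ M → Tendsto (pderiv q a) (𝓝[S] p) (𝓝 (A q)) := by
    intro q hq
    rw [hA q (mem_Lam.2 hq)]
    exact tendsto_limFrom (ha.2 q (mem_Lam.2 hq)) hp
  have lu : ∀ q : ℕ × ℕ, q.1 + q.2 ≤ M + 1 →
      Tendsto (pderiv q u) (𝓝[S] p) (𝓝 (limFrom S (pderiv q u) p)) :=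
    fun q hq => tendsto_limFrom (hu.2 q (mem_Lam.2 hq)) hp
  have lf : Tendsto (fun z => -pderiv q f z) (𝓝[S] p) (𝓝 (-limFrom S (pderiv q f) p)) :=
    (tendsto_limFrom (hf.2 q (mem_Lam.2 (by omega))) hp).neg
  -- The differentiated equation holds inside S and is polynomial in the derivatives of a, u and f,
  -- so it passes to the limit at the boundary point.
  refine tendsto_nhds_unique (f := fun z => ellipticJet (fun q => pderiv q a z)
    (fun q => pderiv q u z) q) ?_ (lf.congr' ?_)
  · simp only [ellipticJet_apply, leibniz₂_apply, shiftX_apply, shiftY_apply]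
    refine Tendsto.add ?_ ?_
    · refine tendsto_finsetSum _ fun i hi => tendsto_finsetSum _ fun j hj => ?_
      rw [Finset.mem_range] at hi hj
      exact (tendsto_const_nhds.mul (la _ (by simp only; omega))).mul (lu _ (by simp only; omega))
    · refine tendsto_finsetSum _ fun i hi => tendsto_finsetSum _ fun j hj => ?_
      rw [Finset.mem_range] at hi hj
      exact (tendsto_const_nhds.mul (la _ (by simp only; omega))).mul (lu _ (by simp only; omega))
  · refine eventually_nhdsWithin_of_forall fun z hz => ?_
    exact (pderiv_divergence hS q (ha.1.of_le (by exact_mod_cast hq))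
      (hu.1.of_le (by exact_mod_cast (by omega : q.1 + q.2 + 2 ≤ M + 1))) hpde hz).symm

end

/-! ### The normal vector along the interface -/

section

variable {ψ : ℝ × ℝ → ℝ} {p n : ℝ × ℝ}

/-- The two sides of the zero set of `ψ`, uniformly near the point `p`. -/
theorem IsUnitNormal.eventually_sides (h : IsUnitNormal ψ p n) {l : Filter ℝ} {c w : ℝ → ℝ × ℝ}
    (hc : Tendsto c l (𝓝 p)) (hψ : ∀ᶠ t in l, ψ (c t) = 0) {w₀ : ℝ × ℝ} (hw : Tendsto w l (𝓝 w₀))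
    (hpos : 0 < n.1 * w₀.1 + n.2 * w₀.2) :
    ∀ᶠ x : ℝ × ℝ in l ×ˢ 𝓝[>] 0,
      0 < ψ (c x.1 + x.2 • w x.1) ∧ ψ (c x.1 + x.2 • -w x.1) < 0 := by
  obtain ⟨-, φ, hφ, hsign, hgrad⟩ := h
  set d := n.1 * w₀.1 + n.2 * w₀.2 with hd
  have hW : 0 < ‖w₀‖ + 1 := by positivity
  have hc1 : Tendsto (fun x : ℝ × ℝ => c x.1) (l ×ˢ 𝓝[>] 0) (𝓝 p) := hc.comp tendsto_fst
  have hz : Tendsto (fun x : ℝ × ℝ => x.2) (l ×ˢ 𝓝[>] 0) (𝓝 0) :=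
    (tendsto_snd (f := l) (g := 𝓝[>] (0 : ℝ))).mono_right nhdsWithin_le_nhds
  -- Strict differentiability at p is what is needed here: the base point `c x.1` moves along with
  -- the displacement, and the remainder must be small uniformly in both.
  have key : ∀ (w : ℝ → ℝ × ℝ) (w₀ : ℝ × ℝ), Tendsto w l (𝓝 w₀) → ∀ᶠ x : ℝ × ℝ in l ×ˢ 𝓝[>] 0,
      |φ (c x.1 + x.2 • w x.1) - φ (c x.1) - x.2 * (n.1 * (w x.1).1 + n.2 * (w x.1).2)|
        ≤ d / (4 * (‖w₀‖ + 1)) * (x.2 * ‖w x.1‖) ∧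
      ((0 < φ (c x.1 + x.2 • w x.1) ↔ 0 < ψ (c x.1 + x.2 • w x.1)) ∧
        (φ (c x.1 + x.2 • w x.1) < 0 ↔ ψ (c x.1 + x.2 • w x.1) < 0)) := by
    intro w w₀ hw
    have hcw : Tendsto (fun x : ℝ × ℝ => c x.1 + x.2 • w x.1) (l ×ˢ 𝓝[>] 0) (𝓝 p) := by
      simpa using hc1.add (hz.smul (hw.comp tendsto_fst))
    have ho := (hφ.hasStrictFDerivAt one_ne_zero).isLittleO.def
      (show 0 < d / (4 * (‖w₀‖ + 1)) by positivity)
    have hpair := (hcw.prodMk_nhds hc1).eventually ho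
    have hpos2 : ∀ᶠ x : ℝ × ℝ in l ×ˢ 𝓝[>] 0, 0 < x.2 :=
      tendsto_snd.eventually (self_mem_nhdsWithin : Set.Ioi (0 : ℝ) ∈ 𝓝[>] 0)
    filter_upwards [hpair, hpos2, hcw.eventually hsign] with x h1 h2 h3
    refine ⟨?_, h3⟩
    rw [add_sub_cancel_left, hgrad, norm_smul, Real.norm_eq_abs, Real.norm_eq_abs,
      abs_of_pos h2] at h1
    convert h1 using 2
    simp only [Prod.smul_fst, Prod.smul_snd, smul_eq_mul]
    ring
  have hφ0 : ∀ᶠ x : ℝ × ℝ in l ×ˢ 𝓝[>] 0, φ (c x.1) = 0 := by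
    filter_upwards [tendsto_fst.eventually hψ, hc1.eventually hsign] with x h1 h2
    rw [h1] at h2
    exact le_antisymm (not_lt.1 fun h => (lt_irrefl _ (h2.1.1 h))) (not_lt.1 fun h =>
      (lt_irrefl _ (h2.2.1 h)))
  have hpos2 : ∀ᶠ x : ℝ × ℝ in l ×ˢ 𝓝[>] 0, 0 < x.2 :=
    tendsto_snd.eventually (self_mem_nhdsWithin : Set.Ioi (0 : ℝ) ∈ 𝓝[>] 0)
  have hnorm : ∀ᶠ x : ℝ × ℝ in l ×ˢ 𝓝[>] 0, ‖w x.1‖ < ‖w₀‖ + 1 :=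
    (hw.norm.comp tendsto_fst).eventually_lt_const (by linarith)
  have hdot : ∀ᶠ x : ℝ × ℝ in l ×ˢ 𝓝[>] 0, d / 2 < n.1 * (w x.1).1 + n.2 * (w x.1).2 := by
    have ht : Tendsto (fun t => n.1 * (w t).1 + n.2 * (w t).2) l (𝓝 d) :=
      (hw.fst_nhds.const_mul _).add (hw.snd_nhds.const_mul _)
    exact (ht.comp tendsto_fst).eventually_const_lt (by linarith)
  filter_upwards [key w w₀ hw, key (fun t => -w t) (-w₀) hw.neg, hφ0, hpos2, hnorm, hdot]
    with x h1 h2 h3 h4 h5 h6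
  -- The tolerance was chosen so that the remainder is at most h d/4, where h is the displacement,
  -- while the linear term exceeds h d/2; the sign of φ is then that of the linear term.
  have h7 : d / (4 * (‖w₀‖ + 1)) * (x.2 * ‖w x.1‖) ≤ x.2 * (d / 4) := by
    have e : d / (4 * (‖w₀‖ + 1)) * (x.2 * (‖w₀‖ + 1)) = x.2 * (d / 4) := by
      field_simp
    rw [← e]
    gcongr
  have h8 : x.2 * (d / 2) < x.2 * (n.1 * (w x.1).1 + n.2 * (w x.1).2) := by gcongr
  have h9 : 0 < x.2 * (d / 4) := by positivity
  obtain ⟨a1, a2, -⟩ := h1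
  obtain ⟨b1, -, b2⟩ := h2
  rw [h3, abs_le] at a1 b1
  simp only [norm_neg, Prod.fst_neg, Prod.snd_neg] at b1
  exact ⟨a2.1 (by linarith [a1.1]), b2.1 (by linarith [b1.2])⟩

/-- The defining function φ vanishes along the curve, so its derivative in the direction of the
velocity is zero. -/
theorem IsUnitNormal.orthogonal {c : ℝ → ℝ × ℝ} {t : ℝ} {v : ℝ × ℝ} (h : IsUnitNormal ψ (c t) n)
    (hc : HasDerivAt c v t) (hψ : ∀ᶠ u in 𝓝 t, ψ (c u) = 0) : n.1 * v.1 + n.2 * v.2 = 0 := by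
  obtain ⟨-, φ, hφ, hsign, hgrad⟩ := h
  have h1 : HasDerivAt (fun u => φ (c u)) (fderiv ℝ φ (c t) v) t :=
    (hφ.differentiableAt one_ne_zero).hasFDerivAt.comp_hasDerivAt t hc
  have h2 : (fun u => φ (c u)) =ᶠ[𝓝 t] fun _ => 0 := by
    filter_upwards [hψ, hc.continuousAt.eventually hsign] with u hu1 hu2
    rw [hu1] at hu2
    exact le_antisymm (not_lt.1 fun h => (lt_irrefl _ (hu2.1.1 h))) (not_lt.1 fun h =>
      (lt_irrefl _ (hu2.2.1 h)))
  rw [← hgrad, ← h1.deriv, h2.deriv_eq, deriv_const]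

/-- The unit normal of a curve is determined up to the sign. -/
theorem IsUnitNormal.cross_sq (h : IsUnitNormal ψ p n) {v : ℝ × ℝ} (hv : n.1 * v.1 + n.2 * v.2 = 0) :
    (n.1 * v.2 - n.2 * v.1) ^ 2 = v.1 ^ 2 + v.2 ^ 2 := by
  -- Lagrange's identity: the squares of the dot and cross products of n and v add up to |n|²|v|².
  linear_combination (v.1 ^ 2 + v.2 ^ 2) * h.1 - (n.1 * v.1 + n.2 * v.2) * hv

end

/-! ### The interface problem -/

namespace InterfaceData

variable {P : InterfaceData} {M : ℕ} {p : ℝ × ℝ} {r s : ℝ → ℝ}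

theorem isOpen_domain : IsOpen P.domain := isOpen_Ioo.prod isOpen_Ioo

theorem IsSolution.isOpen_regionPlus (h : P.IsSolution M) : IsOpen P.regionPlus :=
  h.continuousOn_ψ.isOpen_inter_preimage isOpen_domain isOpen_Ioi

theorem IsSolution.isOpen_regionMinus (h : P.IsSolution M) : IsOpen P.regionMinus :=
  h.continuousOn_ψ.isOpen_inter_preimage isOpen_domain isOpen_Iio

theorem mem_of_mem_regionPlus {z : ℝ × ℝ} (hz : z ∈ P.regionPlus) : z ∈ P.domain \ P.interface :=
  ⟨hz.1, fun h => hz.2.ne' h.2⟩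

theorem mem_of_mem_regionMinus {z : ℝ × ℝ} (hz : z ∈ P.regionMinus) : z ∈ P.domain \ P.interface :=
  ⟨hz.1, fun h => hz.2.ne h.2⟩

/-- The curve `t ↦ p + (r t, s t)`. -/
def curve (p : ℝ × ℝ) (r s : ℝ → ℝ) (t : ℝ) : ℝ × ℝ := (p.1 + r t, p.2 + s t)

theorem curve_zero (hr : r 0 = 0) (hs : s 0 = 0) : curve p r s 0 = p := by
  simp [curve, hr, hs]

/-- A parameter interval on which the interface is regular and its two sides are uniformly
accessible. -/
structure IsRegularInterval (P : InterfaceData) (M : ℕ) (p : ℝ × ℝ) (r s : ℝ → ℝ) (I : Set ℝ) :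
    Prop where
  isOpen : IsOpen I
  zero_mem : (0 : ℝ) ∈ I
  contDiffOn_r : ContDiffOn ℝ (M + 1 : ℕ) r I
  contDiffOn_s : ContDiffOn ℝ (M + 1 : ℕ) s I
  hasDerivAt : ∀ t ∈ I, HasDerivAt (curve p r s) (deriv r t, deriv s t) t
  pos : ∀ t ∈ I, 0 < deriv r t ^ 2 + deriv s t ^ 2
  mem_interface : ∀ t ∈ I, curve p r s t ∈ P.interface
  bounded : ∃ C, ∀ t ∈ I, |deriv r t| ≤ C ∧ |deriv s t| ≤ C
  pushes_plus : ∃ n, Pushes P.regionPlus I (curve p r s) n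
  pushes_minus : ∃ n, Pushes P.regionMinus I (curve p r s) n
  normal : ∀ t ∈ I,
    (P.normal (curve p r s t)).1 * √(deriv r t ^ 2 + deriv s t ^ 2)
      = P.orientation p r s * deriv s t ∧
    (P.normal (curve p r s t)).2 * √(deriv r t ^ 2 + deriv s t ^ 2)
      = -(P.orientation p r s * deriv r t)
  orientation_sq : P.orientation p r s * P.orientation p r s = 1

/-- A product filter supplies one range of displacements valid for all t near zero, which is the
uniformity that `Pushes` asks for. -/
theorem pushes_of_eventually {S : Set (ℝ × ℝ)} {c : ℝ → ℝ × ℝ} {n : ℝ × ℝ}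
    (h : ∀ᶠ x : ℝ × ℝ in 𝓝 0 ×ˢ 𝓝[>] 0, c x.1 + x.2 • n ∈ S) :
    ∀ᶠ I in (𝓝 (0 : ℝ)).smallSets, Pushes S I c n := by
  obtain ⟨pa, ha, pb, hb, hab⟩ := eventually_prod_iff.1 h
  obtain ⟨δ, hδ, hsub⟩ := mem_nhdsGT_iff_exists_Ioo_subset.1 hb
  refine eventually_smallSets.2 ⟨_, ha, fun I hI => ⟨δ, hδ, fun t ht k hk => hab (hI ht) (hsub hk)⟩⟩

/-- The regular intervals are arbitrarily small. -/
theorem IsSolution.exists_isRegularInterval (h : P.IsSolution M) (hp : p ∈ P.interface)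
    (hl : P.IsLocalParam M p r s) {Q : ℝ → Prop} (hQ : ∀ᶠ t in 𝓝 0, Q t) :
    ∃ I, P.IsRegularInterval M p r s I ∧ ∀ t ∈ I, Q t := by
  obtain ⟨hr0, hs0, ε, hε, hr, hs, hI⟩ := hl
  have hI0 : Set.Ioo (-ε) ε ∈ 𝓝 (0 : ℝ) := Ioo_mem_nhds (by linarith) hε
  have hr' : ContinuousOn (deriv r) (Set.Ioo (-ε) ε) := (contDiffOn_deriv isOpen_Ioo hr).continuousOn
  have hs' : ContinuousOn (deriv s) (Set.Ioo (-ε) ε) := (contDiffOn_deriv isOpen_Ioo hs).continuousOn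
  have hd : ∀ t ∈ Set.Ioo (-ε) ε, HasDerivAt (curve p r s) (deriv r t, deriv s t) t := by
    intro t ht
    have h1 := ((hr.contDiffAt (isOpen_Ioo.mem_nhds ht)).differentiableAt (by simp)).hasDerivAt
    have h2 := ((hs.contDiffAt (isOpen_Ioo.mem_nhds ht)).differentiableAt (by simp)).hasDerivAt
    exact (h1.const_add _).prodMk (h2.const_add _)
  have hψ : ∀ t ∈ Set.Ioo (-ε) ε, ∀ᶠ u in 𝓝 t, P.ψ (curve p r s u) = 0 := by
    intro t ht
    filter_upwards [isOpen_Ioo.mem_nhds ht] with u hu using (hI u hu).2.2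
  have h0 : (0 : ℝ) ∈ Set.Ioo (-ε) ε := ⟨by linarith, hε⟩
  have hc0 : curve p r s 0 = p := curve_zero hr0 hs0
  have hct : Tendsto (curve p r s) (𝓝 0) (𝓝 p) := by
    have := (hd 0 h0).continuousAt.tendsto
    rwa [hc0] at this
  have hn := h.normal_spec p hp
  have hcross : ∀ t ∈ Set.Ioo (-ε) ε, ((P.normal (curve p r s t)).1 * deriv s t
      - (P.normal (curve p r s t)).2 * deriv r t) ^ 2 = deriv r t ^ 2 + deriv s t ^ 2 := by
    intro t ht
    have hnt := h.normal_spec _ (hI t ht).2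
    exact hnt.cross_sq (v := (deriv r t, deriv s t)) 
      (IsUnitNormal.orthogonal (c := curve p r s) hnt (hd t ht) (hψ t ht))
  set σ := P.orientation p r s with hσ
  have hne0 : (P.normal p).1 * deriv s 0 - (P.normal p).2 * deriv r 0 ≠ 0 := by
    intro e
    have h1 := hcross 0 h0
    rw [hc0, e] at h1
    have := (hI 0 h0).1
    rw [← h1] at this
    simp at this
  have hσ1 : σ * σ = 1 := by
    rw [hσ, orientation]
    rcases Real.sign_apply_eq_of_ne_zero _ hne0 with e | e <;> rw [e] <;> norm_num
  have hσpos : 0 < σ * ((P.normal p).1 * deriv s 0 - (P.normal p).2 * deriv r 0) := by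
    rw [hσ, orientation]
    exact Real.sign_mul_pos_of_ne_zero _ hne0
  -- The moving normal σ(s', -r') is used to carry the orientation from p to nearby points: no
  -- continuity of the field `normal` is assumed.
  have hw : Tendsto (fun t => (σ * deriv s t, -(σ * deriv r t))) (𝓝 0)
      (𝓝 (σ * deriv s 0, -(σ * deriv r 0))) :=
    Tendsto.prodMk_nhds (((hs'.continuousAt hI0).tendsto).const_mul σ)
      (((hr'.continuousAt hI0).tendsto).const_mul σ).neg
  have hside := hn.eventually_sides hct (hψ 0 h0) hw (by simp only; linarith)
  have hsame : ∀ᶠ t in 𝓝 (0 : ℝ), ∀ᶠ k in 𝓝[>] (0 : ℝ),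
      P.ψ (curve p r s t + k • -(σ * deriv s t, -(σ * deriv r t))) < 0 :=
    hside.curry.mono fun t ht => ht.mono fun k hk => hk.2
  -- The fixed direction `P.normal p` pushes the whole nearby arc into either region, so the
  -- displaced curves are translates and keep the velocity.
  have hside1 := hn.eventually_sides hct (hψ 0 h0) (tendsto_const_nhds (x := P.normal p))
    (by nlinarith [hn.1])
  have hz : Tendsto (fun x : ℝ × ℝ => x.2) (𝓝 (0 : ℝ) ×ˢ 𝓝[>] 0) (𝓝 0) :=
    tendsto_snd.mono_right nhdsWithin_le_nhds
  have hdom : ∀ n : ℝ × ℝ, ∀ᶠ x : ℝ × ℝ in 𝓝 0 ×ˢ 𝓝[>] 0,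
      curve p r s x.1 + x.2 • n ∈ P.domain := by
    intro n
    have : Tendsto (fun x : ℝ × ℝ => curve p r s x.1 + x.2 • n) (𝓝 0 ×ˢ 𝓝[>] 0) (𝓝 p) := by
      simpa using (hct.comp tendsto_fst).add (hz.smul (tendsto_const_nhds (x := n)))
    exact this.eventually (isOpen_domain.mem_nhds hp.1)
  have hplus : ∀ᶠ I in (𝓝 (0 : ℝ)).smallSets, Pushes P.regionPlus I (curve p r s) (P.normal p) := by
    refine pushes_of_eventually ?_
    filter_upwards [hside1, hdom (P.normal p)] with x h1 h2 using ⟨h2, h1.1⟩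
  have hminus : ∀ᶠ I in (𝓝 (0 : ℝ)).smallSets, Pushes P.regionMinus I (curve p r s) (-P.normal p) := by
    refine pushes_of_eventually ?_
    filter_upwards [hside1, hdom (-P.normal p)] with x h1 h2 using ⟨h2, h1.2⟩
  have hbr : ∀ᶠ t in 𝓝 (0 : ℝ), |deriv r t| < |deriv r 0| + |deriv s 0| + 1 :=
    (hr'.continuousAt hI0).abs.eventually_lt_const (by linarith [abs_nonneg (deriv s 0)])
  have hbs : ∀ᶠ t in 𝓝 (0 : ℝ), |deriv s t| < |deriv r 0| + |deriv s 0| + 1 :=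
    (hs'.continuousAt hI0).abs.eventually_lt_const (by linarith [abs_nonneg (deriv r 0)])
  have hall : ∀ᶠ t in 𝓝 (0 : ℝ), t ∈ Set.Ioo (-ε) ε ∧ Q t ∧
      (∀ᶠ k in 𝓝[>] (0 : ℝ), P.ψ (curve p r s t + k • -(σ * deriv s t, -(σ * deriv r t))) < 0) ∧
      |deriv r t| < |deriv r 0| + |deriv s 0| + 1 ∧ |deriv s t| < |deriv r 0| + |deriv s 0| + 1 := by
    filter_upwards [hI0, hQ, hsame, hbr, hbs] with t h1 h2 h3 h4 h5 using ⟨h1, h2, h3, h4, h5⟩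
  obtain ⟨U, hU, hUsub⟩ := eventually_smallSets.1 (hplus.and hminus)
  obtain ⟨δ, hδ, hball⟩ := Metric.mem_nhds_iff.1 (Filter.inter_mem hU hall)
  have hb : ∀ t ∈ Metric.ball (0 : ℝ) δ, _ := fun t ht => (hball ht).2
  have hsub : Metric.ball (0 : ℝ) δ ⊆ Set.Ioo (-ε) ε := fun t ht => (hb t ht).1
  obtain ⟨hp1, hp2⟩ := hUsub (Metric.ball 0 δ) fun t ht => (hball ht).1
  refine ⟨Metric.ball 0 δ, ⟨Metric.isOpen_ball, Metric.mem_ball_self hδ, hr.mono hsub, hs.mono hsub,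
    fun t ht => hd t (hsub ht), fun t ht => (hI t (hsub ht)).1, fun t ht => (hI t (hsub ht)).2,
    ⟨_, fun t ht => ⟨(hb t ht).2.2.2.1.le, (hb t ht).2.2.2.2.le⟩⟩, ⟨_, hp1⟩, ⟨_, hp2⟩,
    fun t ht => ?_, hσ1⟩, fun t ht => (hb t ht).2.1⟩
  have hnt := h.normal_spec _ (hI t (hsub ht)).2
  change IsUnitNormal P.ψ (curve p r s t) (P.normal (curve p r s t)) at hnt
  have hcr := hcross t (hsub ht)
  have hort := IsUnitNormal.orthogonal hnt (hd t (hsub ht)) (hψ t (hsub ht))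
  have hpos := (hI t (hsub ht)).1
  set n := P.normal (curve p r s t) with hn_def
  simp only at hort
  -- If the normal at this point had the opposite orientation, moving along -σ(s', -r') would lead
  -- into the positive region, while near p that direction leads into the negative one.
  have hnonneg : 0 ≤ σ * (n.1 * deriv s t - n.2 * deriv r t) := by
    by_contra hneg
    have h1 := hnt.eventually_sides (l := pure t) (c := curve p r s)
      (w := fun _ => -(σ * deriv s t, -(σ * deriv r t)))
      (w₀ := -(σ * deriv s t, -(σ * deriv r t))) (tendsto_pure_nhds _ t)
      (eventually_pure.2 (hI t (hsub ht)).2.2) tendsto_const_nhds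
      (by simp only [Prod.fst_neg, Prod.snd_neg]; linarith)
    rw [pure_prod, eventually_map] at h1
    obtain ⟨k, hk1, hk2⟩ := (h1.and (hb t ht).2.2.1).exists
    exact lt_asymm hk1.1 hk2
  have hv : √(deriv r t ^ 2 + deriv s t ^ 2) = σ * (n.1 * deriv s t - n.2 * deriv r t) := by
    rw [← hcr, Real.sqrt_eq_iff_eq_sq (sq_nonneg _) hnonneg]
    linear_combination -(n.1 * deriv s t - n.2 * deriv r t) ^ 2 * hσ1
  rw [hv]
  have hn1 := hnt.1
  constructor
  · linear_combination σ * deriv s t * hn1 - σ * n.2 * hort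
  · linear_combination -σ * deriv r t * hn1 + σ * n.1 * hort

end InterfaceData

/-! ### The transmission relations hold for solutions -/

theorem iteratedDeriv_mul_eq_leibniz {f g : ℝ → ℝ} {t : ℝ} {k : ℕ} (hf : ContDiffAt ℝ k f t)
    (hg : ContDiffAt ℝ k g t) {x y : ℕ → ℝ} (hx : ∀ i ≤ k, x i = iteratedDeriv i f t)
    (hy : ∀ i ≤ k, y i = iteratedDeriv i g t) :
    iteratedDeriv k (fun t => f t * g t) t = leibniz x y k := by
  rw [iteratedDeriv_fun_mul hf hg, leibniz_apply]
  refine Finset.sum_congr rfl fun i hi => ?_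
  rw [hx i (Nat.lt_succ_iff.1 (Finset.mem_range.1 hi)), hy (k - i) (Nat.sub_le _ _)]

theorem IsCurveFamily.const_mul {I : Set ℝ} {r s : ℝ → ℝ} {K : ℕ} {y : ℕ × ℕ → ℝ → ℝ}
    (hy : IsCurveFamily I r s K y) (c : ℝ) : IsCurveFamily I r s K fun q t => c * y q t := by
  refine ⟨fun q hq => continuousOn_const.mul (hy.continuousOn q hq), fun q hq t ht => ?_⟩
  refine ((hy.hasDerivAt q hq t ht).const_mul c).congr_deriv ?_
  ring

namespace InterfaceData

variable {P : InterfaceData} {M : ℕ} {p : ℝ × ℝ} {r s : ℝ → ℝ} {I : Set ℝ}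

theorem jet_rSeq {k : ℕ} (hk : k ≤ M + 1) : (P.jet M p r s).rSeq k = iteratedDeriv k r 0 :=
  dif_pos (by omega)

theorem jet_sSeq {k : ℕ} (hk : k ≤ M + 1) : (P.jet M p r s).sSeq k = iteratedDeriv k s 0 :=
  dif_pos (by omega)

theorem jet_coeffPlus {q : ℕ × ℕ} (hq : q ∈ Lam M) :
    (P.jet M p r s).coeffPlus q = P.derivPlus P.a p q := dif_pos hq

theorem jet_coeffMinus {q : ℕ × ℕ} (hq : q ∈ Lam M) :
    (P.jet M p r s).coeffMinus q = P.derivMinus P.a p q := dif_pos hq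

namespace IsRegularInterval

theorem contDiffOn_deriv_r (h : P.IsRegularInterval M p r s I) : ContDiffOn ℝ M (deriv r) I := contDiffOn_deriv h.isOpen h.contDiffOn_r

theorem contDiffOn_deriv_s (h : P.IsRegularInterval M p r s I) : ContDiffOn ℝ M (deriv s) I := contDiffOn_deriv h.isOpen h.contDiffOn_s

theorem iteratedDeriv_trace (h : P.IsRegularInterval M p r s I) {K : ℕ} (hK : K ≤ M + 1) {y : ℕ × ℕ → ℝ → ℝ}
    (hy : IsCurveFamily I r s K y) {G : ℕ × ℕ → ℝ} (hG : ∀ q : ℕ × ℕ, q.1 + q.2 ≤ K → G q = y q 0)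
    {q : ℕ × ℕ} {k : ℕ} (hk : q.1 + q.2 + k ≤ K) :
    traceJet (P.jet M p r s).rSeq (P.jet M p r s).sSeq q G k = iteratedDeriv k (y q) 0 :=
  (hy.iteratedDeriv_eq h.isOpen h.zero_mem (h.contDiffOn_r.of_le (by exact_mod_cast hK))
    (h.contDiffOn_s.of_le (by exact_mod_cast hK)) (fun _ hi => jet_rSeq (hi.trans hK))
    (fun _ hi => jet_sSeq (hi.trans hK)) hG k q hk).symm

theorem contDiffAt_trace (h : P.IsRegularInterval M p r s I) {K : ℕ} (hK : K ≤ M + 1) {y : ℕ × ℕ → ℝ → ℝ}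
    (hy : IsCurveFamily I r s K y) {q : ℕ × ℕ} {k : ℕ} (hk : q.1 + q.2 + k ≤ K) :
    ContDiffAt ℝ k (y q) 0 :=
  (hy.contDiffOn h.isOpen (h.contDiffOn_r.of_le (by exact_mod_cast hK))
    (h.contDiffOn_s.of_le (by exact_mod_cast hK)) k q hk).contDiffAt (h.isOpen.mem_nhds h.zero_mem)

theorem contDiffAt_deriv_r (h : P.IsRegularInterval M p r s I) {k : ℕ} (hk : k ≤ M) : ContDiffAt ℝ k (deriv r) 0 :=
  (h.contDiffOn_deriv_r.contDiffAt (h.isOpen.mem_nhds h.zero_mem)).of_le (by exact_mod_cast hk)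

theorem contDiffAt_deriv_s (h : P.IsRegularInterval M p r s I) {k : ℕ} (hk : k ≤ M) : ContDiffAt ℝ k (deriv s) 0 :=
  (h.contDiffOn_deriv_s.contDiffAt (h.isOpen.mem_nhds h.zero_mem)).of_le (by exact_mod_cast hk)

end IsRegularInterval

theorem jet_rSeq_succ {k : ℕ} (hk : k ≤ M) :
    (P.jet M p r s).rSeq (k + 1) = iteratedDeriv k (deriv r) 0 := by
  rw [jet_rSeq (by omega), iteratedDeriv_succ']

theorem jet_sSeq_succ {k : ℕ} (hk : k ≤ M) :
    (P.jet M p r s).sSeq (k + 1) = iteratedDeriv k (deriv s) 0 := by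
  rw [jet_sSeq (by omega), iteratedDeriv_succ']

namespace IsRegularInterval

theorem iteratedDeriv_flux (h : P.IsRegularInterval M p r s I) {yA yU : ℕ × ℕ → ℝ → ℝ}
    (hA : IsCurveFamily I r s M yA) (hU : IsCurveFamily I r s (M + 1) yU) {A U : ℕ × ℕ → ℝ}
    (hA₀ : ∀ q : ℕ × ℕ, q.1 + q.2 ≤ M → A q = yA q 0) (hU₀ : ∀ q, U q = yU q 0) {k : ℕ}
    (hk : k ≤ M) :
    fluxJet (P.jet M p r s).rSeq (P.jet M p r s).sSeq A U k
      = iteratedDeriv k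
        (fun t => yA (0, 0) t * (deriv s t * yU (1, 0) t - deriv r t * yU (0, 1) t)) 0 := by
  have cx : ∀ i ≤ k, ContDiffAt ℝ i (fun t => deriv s t * yU (1, 0) t) 0 := fun i hi =>
    (h.contDiffAt_deriv_s (hi.trans hk)).mul (h.contDiffAt_trace le_rfl hU (by simp only; omega))
  have cy : ∀ i ≤ k, ContDiffAt ℝ i (fun t => deriv r t * yU (0, 1) t) 0 := fun i hi =>
    (h.contDiffAt_deriv_r (hi.trans hk)).mul (h.contDiffAt_trace le_rfl hU (by simp only; omega))
  rw [fluxJet_apply]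
  refine (iteratedDeriv_mul_eq_leibniz (h.contDiffAt_trace (by omega) hA (by simpa using hk))
    ((cx k le_rfl).sub (cy k le_rfl)) (fun i hi => h.iteratedDeriv_trace (by omega) hA hA₀
      (by simp only; omega)) fun i hi => ?_).symm
  refine Eq.trans ?_ (iteratedDeriv_sub (cx i hi) (cy i hi)).symm
  rw [Pi.sub_apply]
  congr 1
  · exact (iteratedDeriv_mul_eq_leibniz (h.contDiffAt_deriv_s (hi.trans hk))
      (h.contDiffAt_trace le_rfl hU (by simp only; omega)) (fun j hj => jet_sSeq_succ (by omega))
      fun j hj => h.iteratedDeriv_trace le_rfl hU (fun q _ => hU₀ q) (by simp only; omega)).symm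
  · exact (iteratedDeriv_mul_eq_leibniz (h.contDiffAt_deriv_r (hi.trans hk))
      (h.contDiffAt_trace le_rfl hU (by simp only; omega)) (fun j hj => jet_rSeq_succ (by omega))
      fun j hj => h.iteratedDeriv_trace le_rfl hU (fun q _ => hU₀ q) (by simp only; omega)).symm

theorem contDiffAt_speed (h : P.IsRegularInterval M p r s I) {k : ℕ} (hk : k ≤ M) :
    ContDiffAt ℝ k (fun t => √(deriv r t ^ 2 + deriv s t ^ 2)) 0 :=
  (((h.contDiffAt_deriv_r hk).pow 2).add ((h.contDiffAt_deriv_s hk).pow 2)).sqrt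
    (h.pos 0 h.zero_mem).ne'

/-- Differentiating the identity speed² = r'² + s'² by the Leibniz rule gives the required
relations. -/
theorem isSpeedJet (h : P.IsRegularInterval M p r s I) :
    IsSpeedJet (P.jet M p r s).rSeq (P.jet M p r s).sSeq M
      fun k => iteratedDeriv k (fun t => √(deriv r t ^ 2 + deriv s t ^ 2)) 0 := by
  refine ⟨?_, fun k hk => ?_⟩
  · beta_reduce
    rw [iteratedDeriv_zero]
    exact Real.sqrt_pos.2 (h.pos 0 h.zero_mem)
  · rw [← iteratedDeriv_mul_eq_leibniz (h.contDiffAt_speed hk) (h.contDiffAt_speed hk)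
        (fun _ _ => rfl) (fun _ _ => rfl),
      ← iteratedDeriv_mul_eq_leibniz (h.contDiffAt_deriv_r hk) (h.contDiffAt_deriv_r hk)
        (fun i hi => jet_rSeq_succ (by omega)) (fun i hi => jet_rSeq_succ (by omega)),
      ← iteratedDeriv_mul_eq_leibniz (h.contDiffAt_deriv_s hk) (h.contDiffAt_deriv_s hk)
        (fun i hi => jet_sSeq_succ (by omega)) (fun i hi => jet_sSeq_succ (by omega))]
    refine Eq.trans ?_ (iteratedDeriv_add ((h.contDiffAt_deriv_r hk).mul (h.contDiffAt_deriv_r hk))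
      ((h.contDiffAt_deriv_s hk).mul (h.contDiffAt_deriv_s hk)))
    congr 1
    funext t
    rw [Real.mul_self_sqrt (by positivity)]
    simp only [Pi.add_apply]
    ring

theorem isCurveFamily_plus (h : P.IsRegularInterval M p r s I) (hP : P.IsSolution M) {K : ℕ}
    {F : ℝ × ℝ → ℝ} (hF : UniformlySmoothOn K F P.regionPlus) :
    IsCurveFamily I r s K fun q t => limFrom P.regionPlus (pderiv q F) (curve p r s t) := by
  obtain ⟨n, hn⟩ := h.pushes_plus
  obtain ⟨C, hC⟩ := h.bounded
  exact hn.isCurveFamily hP.isOpen_regionPlus h.isOpen hF h.hasDerivAt (fun t ht => (hC t ht).1)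
    fun t ht => (hC t ht).2

theorem isCurveFamily_minus (h : P.IsRegularInterval M p r s I) (hP : P.IsSolution M) {K : ℕ}
    {F : ℝ × ℝ → ℝ} (hF : UniformlySmoothOn K F P.regionMinus) :
    IsCurveFamily I r s K fun q t => limFrom P.regionMinus (pderiv q F) (curve p r s t) := by
  obtain ⟨n, hn⟩ := h.pushes_minus
  obtain ⟨C, hC⟩ := h.bounded
  exact hn.isCurveFamily hP.isOpen_regionMinus h.isOpen hF h.hasDerivAt (fun t ht => (hC t ht).1)
    fun t ht => (hC t ht).2

theorem mem_closure_plus (h : P.IsRegularInterval M p r s I) {t : ℝ} (ht : t ∈ I) :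
    curve p r s t ∈ closure P.regionPlus :=
  h.pushes_plus.choose_spec.mem_closure ht

theorem mem_closure_minus (h : P.IsRegularInterval M p r s I) {t : ℝ} (ht : t ∈ I) :
    curve p r s t ∈ closure P.regionMinus :=
  h.pushes_minus.choose_spec.mem_closure ht

end IsRegularInterval

end InterfaceData

/-- The one-sided limit of the flux in the direction `n`. -/
theorem limFrom_flux {S : Set (ℝ × ℝ)} {z n : ℝ × ℝ} {M : ℕ} {a u : ℝ × ℝ → ℝ}
    (hz : z ∈ closure S) (ha : UniformlySmoothOn M a S) (hu : UniformlySmoothOn (M + 1) u S) :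
    limFrom S (fun w => a w * (partialX u w * n.1 + partialY u w * n.2)) z
      = limFrom S (pderiv (0, 0) a) z * (limFrom S (pderiv (1, 0) u) z * n.1
        + limFrom S (pderiv (0, 1) u) z * n.2) :=
  limFrom_eq hz ((tendsto_limFrom (ha.2 (0, 0) (mem_Lam.2 (by simp))) hz).mul
    (((tendsto_limFrom (hu.2 (1, 0) (mem_Lam.2 (by simp))) hz).mul_const _).add
      ((tendsto_limFrom (hu.2 (0, 1) (mem_Lam.2 (by simp))) hz).mul_const _)))

namespace InterfaceData

variable {P : InterfaceData} {M : ℕ} {p : ℝ × ℝ} {r s : ℝ → ℝ} {I : Set ℝ}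

/-- The arrays of derivatives of an interface problem at the point `p`. -/
def arrays (P : InterfaceData) (p : ℝ × ℝ) (r s : ℝ → ℝ) : ArraySpace :=
  -- The orientation sign is stored with the derivatives of g_N, so that the relations themselves
  -- depend on the jet alone and the sign reappears as a factor in the formula.
  ![P.derivPlus P.u p, P.derivMinus P.u p, P.derivPlus P.f p, P.derivMinus P.f p,
    fun q => pderiv q P.gD p, fun q => P.orientation p r s * pderiv q P.gN p]

/-- The flux condition along the curve. -/
theorem IsRegularInterval.flux_eq (h : P.IsRegularInterval M p r s I) (hP : P.IsSolution M) {t : ℝ}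
    (ht : t ∈ I) :
    limFrom P.regionPlus (pderiv (0, 0) P.a) (curve p r s t)
        * (deriv s t * limFrom P.regionPlus (pderiv (1, 0) P.u) (curve p r s t)
          - deriv r t * limFrom P.regionPlus (pderiv (0, 1) P.u) (curve p r s t))
      - limFrom P.regionMinus (pderiv (0, 0) P.a) (curve p r s t)
        * (deriv s t * limFrom P.regionMinus (pderiv (1, 0) P.u) (curve p r s t)
          - deriv r t * limFrom P.regionMinus (pderiv (0, 1) P.u) (curve p r s t))
      = √(deriv r t ^ 2 + deriv s t ^ 2)
        * (P.orientation p r s * pderiv (0, 0) P.gN (curve p r s t)) := by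
  have hj := hP.jump_flux _ (h.mem_interface t ht)
  rw [jump, limFrom_flux (h.mem_closure_plus ht) hP.a_plus hP.u_plus,
    limFrom_flux (h.mem_closure_minus ht) hP.a_minus hP.u_minus] at hj
  rw [show pderiv (0, 0) P.gN = P.gN from rfl, ← hj]
  obtain ⟨hn1, hn2⟩ := h.normal t ht
  have hσ := h.orientation_sq
  generalize P.orientation p r s = σ at *
  generalize limFrom P.regionPlus (pderiv (0, 0) P.a) (curve p r s t) = a₁
  generalize limFrom P.regionMinus (pderiv (0, 0) P.a) (curve p r s t) = a₂
  generalize limFrom P.regionPlus (pderiv (1, 0) P.u) (curve p r s t) = x₁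
  generalize limFrom P.regionMinus (pderiv (1, 0) P.u) (curve p r s t) = x₂
  generalize limFrom P.regionPlus (pderiv (0, 1) P.u) (curve p r s t) = y₁
  generalize limFrom P.regionMinus (pderiv (0, 1) P.u) (curve p r s t) = y₂
  -- Replacing the normal by σ(s', -r') divided by the speed produces σ² on the right, which is 1.
  linear_combination (-σ * (a₁ * x₁ - a₂ * x₂)) * hn1 - σ * (a₁ * y₁ - a₂ * y₂) * hn2
    - (a₁ * x₁ * deriv s t - a₂ * x₂ * deriv s t - a₁ * y₁ * deriv r t + a₂ * y₂ * deriv r t) * hσ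

/-- The derivatives of a solution at a point of the interface satisfy the transmission relations. -/
theorem IsSolution.transmits (hP : P.IsSolution M) (hp : p ∈ P.interface)
    (hl : P.IsLocalParam M p r s) (hD : ContDiffAt ℝ (M + 1 : ℕ) P.gD p)
    (hN : ContDiffAt ℝ M P.gN p) : Transmits (P.jet M p r s) (P.arrays p r s) := by
  have hc0 : curve p r s 0 = p := curve_zero hl.1 hl.2.1
  have hnear : ∀ {U : Set (ℝ × ℝ)}, U ∈ 𝓝 p → ∀ᶠ t in 𝓝 (0 : ℝ), curve p r s t ∈ U := by
    intro U hU
    -- A first regular interval serves only to give continuity of the curve at zero; a smaller one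
    -- is then taken whose arc stays where g_D and g_N are smooth.
    obtain ⟨I, h, -⟩ := hP.exists_isRegularInterval hp hl (Q := fun _ => True) (by simp)
    have := (h.hasDerivAt 0 h.zero_mem).continuousAt
    exact this (by rwa [hc0])
  have hopen : ∀ {k : ℕ} {g : ℝ × ℝ → ℝ}, ContDiffAt ℝ k g p →
      ∃ U, IsOpen U ∧ p ∈ U ∧ ContDiffOn ℝ k g U := by
    intro k g hg
    obtain ⟨V, hV, hgV⟩ := hg.contDiffOn le_rfl (by simp)
    obtain ⟨U, hUV, hU, hpU⟩ := mem_nhds_iff.1 hV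
    exact ⟨U, hU, hpU, hgV.mono hUV⟩
  obtain ⟨UD, hUD, hpD, hgD⟩ := hopen hD
  obtain ⟨UN, hUN, hpN, hgN⟩ := hopen hN
  obtain ⟨I, h, hQ⟩ := hP.exists_isRegularInterval hp hl
    ((hnear (hUD.mem_nhds hpD)).and (hnear (hUN.mem_nhds hpN)))
  have yup := h.isCurveFamily_plus hP hP.u_plus
  have yum := h.isCurveFamily_minus hP hP.u_minus
  have yap := h.isCurveFamily_plus hP hP.a_plus
  have yam := h.isCurveFamily_minus hP hP.a_minus
  have yD := isCurveFamily_comp hUD hgD h.hasDerivAt fun t ht => (hQ t ht).1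
  have yN := (isCurveFamily_comp hUN hgN h.hasDerivAt fun t ht => (hQ t ht).2).const_mul
    (P.orientation p r s)
  have hI0 : I ∈ 𝓝 (0 : ℝ) := h.isOpen.mem_nhds h.zero_mem
  refine ⟨?_, ?_, ?_, ?_⟩
  · have hcl := h.mem_closure_plus h.zero_mem
    rw [hc0] at hcl
    exact ellipticJet_limFrom hP.isOpen_regionPlus hP.a_plus hP.u_plus hP.f_plus
      (fun z hz => hP.pde z (mem_of_mem_regionPlus hz)) hcl fun q hq => jet_coeffPlus hq
  · have hcl := h.mem_closure_minus h.zero_mem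
    rw [hc0] at hcl
    exact ellipticJet_limFrom hP.isOpen_regionMinus hP.a_minus hP.u_minus hP.f_minus
      (fun z hz => hP.pde z (mem_of_mem_regionMinus hz)) hcl fun q hq => jet_coeffMinus hq
  · intro k hk
    rw [h.iteratedDeriv_trace le_rfl yup (fun q _ => by rw [hc0]; rfl) (by simpa using hk),
      h.iteratedDeriv_trace le_rfl yum (fun q _ => by rw [hc0]; rfl) (by simpa using hk),
      h.iteratedDeriv_trace le_rfl yD (fun q _ => by rw [hc0]; rfl) (by simpa using hk)]
    refine (iteratedDeriv_sub (h.contDiffAt_trace le_rfl yup (by simpa using hk))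
      (h.contDiffAt_trace le_rfl yum (by simpa using hk))).symm.trans ?_
    refine Filter.EventuallyEq.iteratedDeriv_eq k ?_
    filter_upwards [hI0] with t ht using hP.jump_u _ (h.mem_interface t ht)
  · intro k hk
    rw [h.iteratedDeriv_flux yap yup (fun q hq => by rw [hc0, jet_coeffPlus (mem_Lam.2 hq)]; rfl)
        (fun q => by rw [hc0]; rfl) hk,
      h.iteratedDeriv_flux yam yum (fun q hq => by rw [hc0, jet_coeffMinus (mem_Lam.2 hq)]; rfl)
        (fun q => by rw [hc0]; rfl) hk,
      ← iteratedDeriv_mul_eq_leibniz (h.contDiffAt_speed hk)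
        (h.contDiffAt_trace (by omega) yN (by simpa using hk))
        (fun i hi => h.isSpeedJet.eq_speedJet (hi.trans hk))
        (fun i hi => h.iteratedDeriv_trace (by omega) yN (fun q _ => by rw [hc0]; rfl)
          (by simpa using hi.trans hk))]
    have cflux : ∀ {yA yU : ℕ × ℕ → ℝ → ℝ}, IsCurveFamily I r s M yA →
        IsCurveFamily I r s (M + 1) yU → ContDiffAt ℝ k
          (fun t => yA (0, 0) t * (deriv s t * yU (1, 0) t - deriv r t * yU (0, 1) t)) 0 :=
      fun hA hU => (h.contDiffAt_trace (by omega) hA (by simpa using hk)).mul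
        (((h.contDiffAt_deriv_s hk).mul (h.contDiffAt_trace le_rfl hU (by simp only; omega))).sub
          ((h.contDiffAt_deriv_r hk).mul (h.contDiffAt_trace le_rfl hU (by simp only; omega))))
    refine (iteratedDeriv_sub (cflux yap yup) (cflux yam yum)).symm.trans ?_
    refine Filter.EventuallyEq.iteratedDeriv_eq k ?_
    filter_upwards [hI0] with t ht using h.flux_eq hP ht

theorem IsSolution.jet_regular (hP : P.IsSolution M) (hp : p ∈ P.interface)
    (hl : P.IsLocalParam M p r s) : (P.jet M p r s).Regular := by
  obtain ⟨-, -, ε, hε, -, -, hI⟩ := hl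
  have hpos := (hI 0 ⟨by linarith, hε⟩).1
  refine ⟨?_, ?_, ?_⟩
  · rw [jet_rSeq (by omega), jet_sSeq (by omega), iteratedDeriv_one, iteratedDeriv_one]
    linarith
  · rw [jet_coeffPlus (mem_Lam.2 (by simp))]
    exact (hP.a_pos_interface p hp).1.ne'
  · rw [jet_coeffMinus (mem_Lam.2 (by simp))]
    exact (hP.a_pos_interface p hp).2.ne'

end InterfaceData

/-! ### Choice of the coefficients and the theorem -/

/-- The leading coefficients depend only on the tangent vector and the values of the coefficient. -/
def Jet.topCoeff {M : ℕ} (J : Jet M) (q' q : ℕ × ℕ) : ℝ :=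
  EllipticInterface.topCoeff (J.rSeq 1) (J.sSeq 1) (J.coeffPlus (0, 0) / J.coeffMinus (0, 0))
    (q'.1 + q'.2) q' q

theorem Jet.topCoeff_congr {M : ℕ} {J J' : Jet M} (hr : J.r = J'.r) (hs : J.s = J'.s)
    (hp : J.aPlus (origin M) = J'.aPlus (origin M))
    (hm : J.aMinus (origin M) = J'.aMinus (origin M)) (q' q : ℕ × ℕ) :
    J.topCoeff q' q = J'.topCoeff q' q := by
  rw [Jet.topCoeff, Jet.topCoeff, J.coeffPlus_zero, J'.coeffPlus_zero, J.coeffMinus_zero,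
    J'.coeffMinus_zero, hp, hm, Jet.rSeq, Jet.rSeq, Jet.sSeq, Jet.sSeq, hr, hs]

/-- Transmission coefficients exist for every jet; only those of regular jets matter. -/
theorem exists_coeffs (M : ℕ) (J : Jet M) (q' : ℕ × ℕ) :
    ∃ cu cfp cfm cD cN : ℕ × ℕ → ℝ, J.Regular → q' ∈ LamV1 (M + 1) → ∀ x : ArraySpace,
      Transmits J x →
      x 1 q' = topSum J q' x
        + ∑ q ∈ (LamV1 (M + 1)).filter (fun q => 0 < q.1 + q.2 ∧ q.1 + q.2 < q'.1 + q'.2), cu q * x 0 q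
        + ∑ q ∈ Lam (M - 1), cfp q * x 2 q + ∑ q ∈ Lam (M - 1), cfm q * x 3 q
        + ∑ q ∈ Lam (M + 1), cD q * x 4 q + ∑ q ∈ Lam M, cN q * x 5 q := by
  by_cases h : J.Regular ∧ q' ∈ LamV1 (M + 1)
  · obtain ⟨cu, cfp, cfm, cD, cN, hc⟩ := exists_transmission_coeffs J h.1 h.2
    exact ⟨cu, cfp, cfm, cD, cN, fun _ _ => hc⟩
  · exact ⟨0, 0, 0, 0, 0, fun h1 h2 => absurd ⟨h1, h2⟩ h⟩

end EllipticInterface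

end

theorem theorem2p7 (M : ℕ) (hM : 1 ≤ M) :
    ∃ TuPlus TfPlus TfMinus TgD TgN : EllipticInterface.Jet M → ℕ × ℕ → ℕ × ℕ → ℝ,
      -- the transmission equation, for all problems, base points and parametrizations
      (∀ (P : EllipticInterface.InterfaceData) (p : ℝ × ℝ) (r s : ℝ → ℝ),
        P.IsSolution M → p ∈ P.interface → P.IsLocalParam M p r s →
        ContDiffAt ℝ (M + 1 : ℕ) P.gD p → ContDiffAt ℝ M P.gN p →
        ∀ q' ∈ EllipticInterface.LamV1 (M + 1),
          P.derivMinus P.u p q' =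
            (∑ q ∈ EllipticInterface.LamV1 (M + 1) with q.1 + q.2 ≤ q'.1 + q'.2,
              TuPlus (P.jet M p r s) q' q * P.derivPlus P.u p q)
            + (∑ q ∈ EllipticInterface.Lam (M - 1),
              (TfPlus (P.jet M p r s) q' q * P.derivPlus P.f p q
                + TfMinus (P.jet M p r s) q' q * P.derivMinus P.f p q))
            + (∑ q ∈ EllipticInterface.Lam (M + 1),
              TgD (P.jet M p r s) q' q * EllipticInterface.pderiv q P.gD p)
            + ∑ q ∈ EllipticInterface.Lam M,
              P.orientation p r s * TgN (P.jet M p r s) q' q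
                * EllipticInterface.pderiv q P.gN p) ∧
      -- coefficients of top order depend only on the curve and on the two values of `a`
      (∀ J J' : EllipticInterface.Jet M, J.r = J'.r → J.s = J'.s →
        J.aPlus (EllipticInterface.origin M) = J'.aPlus (EllipticInterface.origin M) →
        J.aMinus (EllipticInterface.origin M) = J'.aMinus (EllipticInterface.origin M) →
        ∀ q' ∈ EllipticInterface.LamV1 (M + 1), ∀ q ∈ EllipticInterface.LamV1 (M + 1),
          q.1 + q.2 = q'.1 + q'.2 → TuPlus J q' q = TuPlus J' q' q) ∧
      -- the coefficients of `u_+^{(0,0)}`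
      (∀ J : EllipticInterface.Jet M,
        TuPlus J (0, 0) (0, 0) = 1 ∧
        ∀ q' ∈ EllipticInterface.LamV1 (M + 1), q' ≠ (0, 0) → TuPlus J q' (0, 0) = 0) := by
  classical
  choose cu cfp cfm cD cN hc using EllipticInterface.exists_coeffs M
  -- Equal orders use the explicit coefficients, lower positive orders those from duality, and the
  -- value of u is omitted when q' has positive order. The last two claims can then be read off for
  -- every jet, regular or not.
  refine ⟨fun J q' q => if q.1 + q.2 = q'.1 + q'.2 then J.topCoeff q' q
    else if 0 < q.1 + q.2 then cu J q' q else 0, cfp, cfm, cD, cN, ?_, ?_, ?_⟩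
  · intro P p r s hP hp hl hD hN q' hq'
    have key := hc _ q' (hP.jet_regular hp hl) hq' _ (hP.transmits hp hl hD hN)
    rw [EllipticInterface.topSum_apply] at key
    have hsplit : ∀ (T c v : ℕ × ℕ → ℝ),
        ∑ q ∈ EllipticInterface.LamV1 (M + 1) with q.1 + q.2 ≤ q'.1 + q'.2,
          (if q.1 + q.2 = q'.1 + q'.2 then T q else if 0 < q.1 + q.2 then c q else 0) * v q
        = ∑ q ∈ EllipticInterface.LamV1 (M + 1) with q.1 + q.2 = q'.1 + q'.2, T q * v q
          + ∑ q ∈ EllipticInterface.LamV1 (M + 1) with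
            0 < q.1 + q.2 ∧ q.1 + q.2 < q'.1 + q'.2, c q * v q := by
      intro T c v
      rw [Finset.sum_filter, Finset.sum_filter, Finset.sum_filter, ← Finset.sum_add_distrib]
      refine Finset.sum_congr rfl fun q _ => ?_
      split_ifs <;> first | omega | simp
    rw [hsplit, Finset.sum_add_distrib]
    refine Eq.trans key ?_
    have hlast : ∀ q, P.orientation p r s * cN (P.jet M p r s) q' q
        * EllipticInterface.pderiv q P.gN p
        = cN (P.jet M p r s) q' q * P.arrays p r s 5 q := fun q => by
      change _ = _ * (P.orientation p r s * EllipticInterface.pderiv q P.gN p)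
      ring
    simp only [hlast]
    rw [← add_assoc]
    rfl
  · intro J J' hr hs hp hm q' _ q _ hqq'
    simp only [if_pos hqq']
    exact EllipticInterface.Jet.topCoeff_congr hr hs hp hm q' q
  · intro J
    refine ⟨?_, fun q' _ hq' => ?_⟩
    · simp only [if_true]
      exact EllipticInterface.topCoeff_zero _ _ _
    · have h0 : (0 : ℕ) ≠ q'.1 + q'.2 := fun h => hq' (Prod.ext (by simp only; omega) (by simp only; omega))
      simp [h0]
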